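/- Let $p\ge 1$, let $\mathbb{R}^d$ carry its Euclidean inner product, and for $1\le\alpha\le p$ let $J_\alpha\subset\mathbb{R}$ be a nondegenerate interval with a base point $s_\alpha\in J_\alpha$. All curves with index $\alpha$ are defined on $J_\alpha$. *Curves.* $\mathcal Q_1$ is the class of smooth curves $\mu$ such that $\|D^j\mu\|$ is constant for every $j\ge 1$. The horizontal space of $\mu\in\mathcal Q_1$ is the span of all values of the derivatives $D^j\mu$, $j\ge 2$; its vertical direction $w$ is the component of $D\mu$ orthogonal to the horizontal space. A *curve tuple* with horizontal space $H\subset\mathbb{R}^d$ is a $p$-tuple $\mu_1,\dots,\mu_p$ of nonaffine curves in $\mathcal Q_1$ whose velocities $D\mu_\alpha$ each lie in an affine hyperplane of $\mathbb{R}^d$, which all have horizontal space $H$, and whose vertical directions $w_1,\dots,w_p$ form a basis of $H^\perp$. *Lie algebras and geodesics.* A step-two stratified Lie algebra $\mathbf g$ on $\mathbb{R}^d$ is a Lie bracket on $\mathbb{R}^d$ with an orthogonal decomposition $\mathbb{R}^d=\mathbf v_1\oplus\mathbf v_2$, $\mathbf v_2\neq 0$, such that $[\mathbf v_1,\mathbf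 v_1]=\mathbf v_2$ and $[\mathbf g,\mathbf v_2]=0$. Its Carnot group is $\mathbb{R}^d$ with the product $xy=x+y+\frac12[x,y]$, with the Carnot-Carathéodory (CC) metric for which the left-invariant fields generated by an orthonormal basis of $\mathbf v_1$ are orthonormal. A normal geodesic is the projection of a bicharacteristic (a solution of Hamilton's equations for the sub-Riemannian Hamiltonian) whose sufficiently short arcs realize the CC distance; the vertical momentum of a bicharacteristic is the (constant) $\mathbf v_2$-component of its covector. A $p$-tuple $c_1,\dots,c_p$ of normal geodesics *has a momentum basis* if the $c_\alpha$ are projections of bicharacteristics whose vertical momenta form a basis of $\mathbf v_2^*$. It is *distinguished* if in addition for each $\alpha$ the derivatives of order $\ge2$ of the projection of $c_\alpha$ to $\mathbf v_1$ span $\mathbf v_1$. *Correspondence.* $(\mu_\alpha)$ and $(\mathbf g,(c_\alpha))$ correspond if $\mu_\alpha$ and $c_\alpha$ have the same orthogonal projection to $\mathbf v_1$, $\mu_\alpha(s_\alpha)=c_\alpha(s_\alpha)$, and there are skew-symmetric operators $A_\alpha$ on $\mathbf v_1$ and vectors $v_\alpha\in\mathbf v_1$, $w_\alpha\in\mathbf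 v_2$ with $D\mu_\alpha(s)=\exp(sA_\alpha)v_\alpha\oplus w_\alpha$ on $J_\alpha$ and $[x,y]=\sum_\alpha\langle A_\alpha x,y\rangle\,w_\alpha$ for all $x,y\in\mathbf v_1$. **Theorem.** (1) Let $\mu_1,\dots,\mu_p$ be a curve tuple with horizontal space $H$. There are unique skew-symmetric operators $A_1,\dots,A_p$ on $H$ such that $D\mu_\alpha(s)=\exp(sA_\alpha)v_\alpha\oplus w_\alpha$ with some $v_\alpha\in H$, $w_\alpha\in H^\perp$; they are invertible. There is a step-two stratified Lie algebra $\mathbf g$ on $\mathbb{R}^d$ with $\mathbf v_1=H$, together with a distinguished $p$-tuple of normal geodesics, corresponding to $(\mu_\alpha)$, if and only if $A_1,\dots,A_p$ are linearly independent. The pair $(\mathbf g,(c_\alpha))$ is unique, even among all pairs of such a Lie algebra with $\mathbf v_1=H$ and a $p$-tuple of normal geodesics corresponding to $(\mu_\alpha)$. (2) Conversely, for every step-two stratified Lie algebra $\mathbf g$ on $\mathbb{R}^d$ and every distinguished $p$-tuple $(c_\alpha)$ of normal geodesics, there is exactly one curve tuple with horizontal space $\mathbf v_1$ that corresponds to $(\mathbf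 g,(c_\alpha))$. (3) For every step-two stratified Lie algebra on $\mathbb{R}^d$ and every $p$-tuple of normal geodesics with a momentum basis (distinguished or not), there is a $p$-tuple of curves in $\mathcal Q_1$ that corresponds to them. -/

import Mathlib

open Set Submodule
open scoped ContDiff RealInnerProductSpace ENNReal Gradient

namespace HelicalCarnot

/-- Euclidean space `ℝ^d`. -/
abbrev Euc (d : ℕ) : Type := EuclideanSpace ℝ (Fin d)

/-! ## Curves all of whose derivatives have constant norm -/

/-- The class `Q_k` of smooth curves `μ : J → ℝ^d` on an interval `J` such that `D^j μ` has
constant Euclidean norm for every `j ≥ k`. -/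
structure IsQ {d : ℕ} (k : ℕ) (J : Set ℝ) (μ : ℝ → Euc d) : Prop where
  smooth : ContDiffOn ℝ ∞ μ J
  norm_const : ∀ j : ℕ, k ≤ j → ∃ r : ℝ, ∀ s ∈ J, ‖iteratedDerivWithin j μ J s‖ = r

/-- `μ` is affine on `J`. -/
def IsAffineCurve {d : ℕ} (J : Set ℝ) (μ : ℝ → Euc d) : Prop :=
  ∃ a b : Euc d, ∀ s ∈ J, μ s = a + s • b

/-- On `J`, the curve `γ` lies in an (affine) hyperplane. -/
def LiesInHyperplane {d : ℕ} (J : Set ℝ) (γ : ℝ → Euc d) : Prop :=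
  ∃ a : Euc d, a ≠ 0 ∧ ∃ b : ℝ, ∀ s ∈ J, ⟪a, γ s⟫ = b

/-- The horizontal space of a curve `μ` in `Q_1`: writing the velocity as
`∑ (x_j cos (η_j s) - y_j sin (η_j s)) + w` with distinct nonzero frequencies, it is the span of
all `x_j, y_j`, that is, the span of all the derivatives of the velocity of positive order. -/
def horizontalSpace {d : ℕ} (J : Set ℝ) (μ : ℝ → Euc d) : Submodule ℝ (Euc d) :=
  span ℝ {x | ∃ j : ℕ, 2 ≤ j ∧ ∃ s ∈ J, x = iteratedDerivWithin j μ J s}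

/-- The vertical direction of a curve `μ` in `Q_1`: the component of its velocity orthogonal to
its horizontal space (computed at a base point; it does not depend on the base point). -/
noncomputable def verticalDirection {d : ℕ} (J : Set ℝ) (s₀ : ℝ) (μ : ℝ → Euc d) : Euc d :=
  (horizontalSpace J μ)ᗮ.starProjection (derivWithin μ J s₀)

/-- The exponential `exp A` of an operator. -/
noncomputable def expOp {V : Type*} [NormedAddCommGroup V] [InnerProductSpace ℝ V]
    (A : V →L[ℝ] V) : V →L[ℝ] V :=
  NormedSpace.exp A

/-- The velocity of `μ` has the form `exp (sA) v ⊕ w` with respect to the orthogonal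
decomposition `ℝ^d = H ⊕ Hᗮ`, where `A` is a skew-symmetric operator on `H`. -/
structure IsHelicalForm {d : ℕ} (J : Set ℝ) (μ : ℝ → Euc d) (H : Submodule ℝ (Euc d))
    (A : H →L[ℝ] H) (v : H) (w : Hᗮ) : Prop where
  skew : ∀ x y : H, ⟪A x, y⟫ = -⟪x, A y⟫
  velocity : ∀ s ∈ J, derivWithin μ J s = (expOp (s • A) v : Euc d) + (w : Euc d)

/-- A `p`-tuple of nonaffine curves in `Q_1`, whose velocities lie in hyperplanes, with common
horizontal space `H` and with vertical directions forming a basis of `Hᗮ`. The curve `μ α` is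
defined on the interval `J α` with base point `s₀ α`. -/
structure IsCurveTuple {d p : ℕ} (J : Fin p → Set ℝ) (s₀ : Fin p → ℝ)
    (H : Submodule ℝ (Euc d)) (μ : Fin p → ℝ → Euc d) : Prop where
  isQ : ∀ α, IsQ 1 (J α) (μ α)
  nonaffine : ∀ α, ¬ IsAffineCurve (J α) (μ α)
  hyperplane : ∀ α, LiesInHyperplane (J α) (fun s => derivWithin (μ α) (J α) s)
  horizontal : ∀ α, horizontalSpace (J α) (μ α) = H
  vertical_linearIndependent :
    LinearIndependent ℝ (fun α => verticalDirection (J α) (s₀ α) (μ α))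
  vertical_span : span ℝ (range fun α => verticalDirection (J α) (s₀ α) (μ α)) = Hᗮ

/-! ## Step-two stratified Lie algebras on `ℝ^d` and their Carnot groups -/

/-- A step-two stratified Lie algebra on the Euclidean space `ℝ^d`: a Lie bracket and an
orthogonal decomposition into layers `V₁` and `V₂ = V₁ᗮ ≠ 0` with `[V₁, V₁] = V₂` and
`[V₁, V₂] = [V₂, V₂] = 0`. -/
@[ext]
structure StratifiedLieAlgebra (d : ℕ) where
  V₁ : Submodule ℝ (Euc d)
  bracket : Euc d →ₗ[ℝ] Euc d →ₗ[ℝ] Euc d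
  bracket_self : ∀ x, bracket x x = 0
  jacobi : ∀ x y z, bracket x (bracket y z) + bracket y (bracket z x)
    + bracket z (bracket x y) = 0
  generates : span ℝ {z | ∃ x ∈ V₁, ∃ y ∈ V₁, z = bracket x y} = V₁ᗮ
  central : ∀ x, ∀ t ∈ V₁ᗮ, bracket x t = 0
  step_two : V₁ᗮ ≠ ⊥

namespace StratifiedLieAlgebra

variable {d : ℕ} (g : StratifiedLieAlgebra d)

/-- The second layer. -/
noncomputable abbrev V₂ : Submodule ℝ (Euc d) := g.V₁ᗮ

/-- The projection onto the first layer. -/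
noncomputable abbrev π₁ : Euc d →L[ℝ] Euc d := g.V₁.starProjection

/-- The projection onto the second layer. -/
noncomputable abbrev π₂ : Euc d →L[ℝ] Euc d := g.V₂.starProjection

theorem bracket_mem (x y : Euc d) : g.bracket x y ∈ g.V₂ := by
  have hx : x - g.π₁ x ∈ g.V₂ := sub_starProjection_mem_orthogonal x
  have hy : y - g.π₁ y ∈ g.V₂ := sub_starProjection_mem_orthogonal y
  have key : ∀ a b, g.bracket a b = - g.bracket b a := by
    intro a b
    have h := g.bracket_self (a + b)
    simp only [map_add, LinearMap.add_apply, g.bracket_self, zero_add, add_zero] at h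
    exact eq_neg_of_add_eq_zero_right h
  have h1 : g.bracket x y = g.bracket x (g.π₁ y) := by
    have := g.central x _ hy
    rwa [map_sub, sub_eq_zero] at this
  have h2 : g.bracket x (g.π₁ y) = g.bracket (g.π₁ x) (g.π₁ y) := by
    have := g.central (g.π₁ y) _ hx
    rw [map_sub, sub_eq_zero] at this
    rw [key, this, ← key]
  rw [h1, h2, V₂, ← g.generates]
  exact subset_span ⟨_, starProjection_apply_mem _ _, _, starProjection_apply_mem _ _, rfl⟩

/-- The group law of the associated Carnot group in exponential coordinates
(the Baker-Campbell-Hausdorff formula). -/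
noncomputable def mul (x y : Euc d) : Euc d := x + y + (1 / 2 : ℝ) • g.bracket x y

theorem mul_assoc (x y z : Euc d) : g.mul (g.mul x y) z = g.mul x (g.mul y z) := by
  have key : ∀ a b, g.bracket a b = - g.bracket b a := by
    intro a b
    have h := g.bracket_self (a + b)
    simp only [map_add, LinearMap.add_apply, g.bracket_self, zero_add, add_zero] at h
    exact eq_neg_of_add_eq_zero_right h
  have h1 : g.bracket x (g.bracket y z) = 0 := g.central _ _ (g.bracket_mem y z)
  have h2 : g.bracket (g.bracket x y) z = 0 := by
    rw [key, g.central _ _ (g.bracket_mem x y), neg_zero]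
  simp only [mul, map_add, map_smul, LinearMap.add_apply, LinearMap.smul_apply, h1, h2]
  module

theorem mul_zero (x : Euc d) : g.mul x 0 = x := by simp [mul]

theorem zero_mul (x : Euc d) : g.mul 0 x = x := by simp [mul]

theorem mul_neg (x : Euc d) : g.mul x (-x) = 0 := by simp [mul, g.bracket_self]

/-- The value at `x` of the left-invariant vector field with value `v` at the identity. -/
noncomputable def leftInvariant (v x : Euc d) : Euc d := v + (1 / 2 : ℝ) • g.bracket x v

theorem hasDerivAt_mul (v x : Euc d) :
    HasDerivAt (fun t : ℝ => g.mul x (t • v)) (g.leftInvariant v x) 0 := by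
  have h : (fun t : ℝ => g.mul x (t • v)) = fun t : ℝ => x + t • g.leftInvariant v x := by
    funext t
    simp only [mul, leftInvariant, map_smul]
    module
  rw [h]
  simpa using ((hasDerivAt_id (0 : ℝ)).smul_const (g.leftInvariant v x)).const_add x

/-! ### Carnot-Carathéodory metric -/

/-- A smooth horizontal curve on `[a, b]`: its tangent vector at each point is the value there of
a left-invariant vector field with generator in `V₁` (the generator is then the `V₁`-component of
the tangent vector, because brackets lie in `V₂`). -/
structure IsHorizontal (γ : ℝ → Euc d) (a b : ℝ) : Prop where
  smooth : ContDiffOn ℝ ∞ γ (Icc a b)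
  tangent : ∀ s ∈ Icc a b, ∃ v ∈ g.V₁, derivWithin γ (Icc a b) s = g.leftInvariant v (γ s)

/-- The length of a horizontal curve, for the sub-Riemannian metric which makes the
left-invariant vector fields generated by an orthonormal basis of `V₁` orthonormal. -/
noncomputable def length (γ : ℝ → Euc d) (a b : ℝ) : ℝ :=
  ∫ s in a..b, ‖g.π₁ (derivWithin γ (Icc a b) s)‖

/-- The Carnot-Carathéodory distance. -/
noncomputable def ccDist (P Q : Euc d) : ℝ≥0∞ :=
  ⨅ (γ : ℝ → Euc d) (a : ℝ) (b : ℝ) (_ : a < b) (_ : g.IsHorizontal γ a b) (_ : γ a = P)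
    (_ : γ b = Q), ENNReal.ofReal (g.length γ a b)

/-- `c` restricted to `[a, b]` realizes the Carnot-Carathéodory distance of its endpoints. -/
def IsMinimizer (c : ℝ → Euc d) (a b : ℝ) : Prop :=
  g.IsHorizontal c a b ∧ ENNReal.ofReal (g.length c a b) = g.ccDist (c a) (c b)

/-! ### Normal geodesics -/

/-- The sub-Riemannian Hamiltonian `½ ∑ ⟨ξ, X_i(x)⟩²` on `T*G = ℝ^d × ℝ^d`, where the `X_i` are
the left-invariant vector fields of an orthonormal basis of `V₁`. Covectors are identified with
vectors by the Euclidean inner product. -/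
noncomputable def hamiltonian (x ξ : Euc d) : ℝ :=
  (1 / 2) * ∑ i, ⟪ξ, g.leftInvariant (stdOrthonormalBasis ℝ g.V₁ i : Euc d) x⟫ ^ 2

/-- `(c, ξ)` is a bicharacteristic on the interval `J`, i.e. solves Hamilton's equations
`c' = ∂H/∂ξ`, `ξ' = -∂H/∂x`. -/
structure IsBicharacteristic (J : Set ℝ) (c ξ : ℝ → Euc d) : Prop where
  position : ∀ s ∈ J, HasDerivWithinAt c (∇ (fun η => g.hamiltonian (c s) η) (ξ s)) J s
  momentum : ∀ s ∈ J, HasDerivWithinAt ξ (-∇ (fun x => g.hamiltonian x (ξ s)) (c s)) J s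

/-- A normal geodesic on the interval `J`: the projection of a bicharacteristic whose
sufficiently short arcs realize the Carnot-Carathéodory distance. -/
structure IsNormalGeodesic (J : Set ℝ) (c : ℝ → Euc d) : Prop where
  normal : ∃ ξ, g.IsBicharacteristic J c ξ
  minimizing : ∀ s ∈ J, ∃ ε > 0, ∀ a ∈ J, ∀ b ∈ J, a < b → |a - s| < ε → |b - s| < ε →
    g.IsMinimizer c a b

/-- The `p`-tuple `c` consists of projections of bicharacteristics whose vertical momenta (the
`V₂`-components of the covectors, which are constant in time) form a basis of `V₂`. -/
def HasMomentumBasis {p : ℕ} (J : Fin p → Set ℝ) (s₀ : Fin p → ℝ) (c : Fin p → ℝ → Euc d) :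
    Prop :=
  ∃ ξ : Fin p → ℝ → Euc d, (∀ α, g.IsBicharacteristic (J α) (c α) (ξ α)) ∧
    LinearIndependent ℝ (fun α => g.π₂ (ξ α (s₀ α))) ∧
    span ℝ (range fun α => g.π₂ (ξ α (s₀ α))) = g.V₂

/-- A distinguished `p`-tuple of normal geodesics: the vertical momenta form a basis of `V₂`, and
the horizontal space of each horizontal projection is all of `V₁`. -/
structure IsDistinguished {p : ℕ} (J : Fin p → Set ℝ) (s₀ : Fin p → ℝ)
    (c : Fin p → ℝ → Euc d) : Prop where
  geodesic : ∀ α, g.IsNormalGeodesic (J α) (c α)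
  momenta : g.HasMomentumBasis J s₀ c
  full : ∀ α, horizontalSpace (J α) (fun s => g.π₁ (c α s)) = g.V₁

/-- The correspondence between tuples of curves `μ` and pairs `(g, c)`: `μ α` and `c α` have the
same horizontal projection and the same base point, and if `exp (s A_α) v_α ⊕ w_α` is the
velocity of `μ α`, then `[x, y] = ∑ ⟪A_α x, y⟫ w_α` on `V₁`. -/
structure Corresponds {p : ℕ} (J : Fin p → Set ℝ) (s₀ : Fin p → ℝ) (μ c : Fin p → ℝ → Euc d) :
    Prop where
  projection : ∀ α, ∀ s ∈ J α, g.π₁ (μ α s) = g.π₁ (c α s)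
  base : ∀ α, μ α (s₀ α) = c α (s₀ α)
  structure_eq : ∃ (A : Fin p → g.V₁ →L[ℝ] g.V₁) (v : Fin p → g.V₁) (w : Fin p → g.V₁ᗮ),
    (∀ α, IsHelicalForm (J α) (μ α) g.V₁ (A α) (v α) (w α)) ∧
    ∀ x y : g.V₁, g.bracket x y = ∑ α, ⟪A α x, y⟫ • (w α : Euc d)

end StratifiedLieAlgebra

end HelicalCarnot

open HelicalCarnot

/-!
The theorem translates between two descriptions of the same data by solving linear equations.

*Curves.* If all derivatives of order `≥ 1` of a curve `μ` have constant norm, then differentiating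
the constant inner products shows that the whole Gram matrix of these derivatives is constant
(`IsConstNormFamily.inner_eq`). Linear relations between the derivatives therefore persist in time,
and sending each derivative to the next one defines a skew-symmetric operator `A` on the span of
the derivatives of order `≥ 2`, which is the horizontal space (`exists_generator`). This gives
`μ' = exp (s A) v + w` with `A` invertible and `w` the vertical direction
(`IsQ.exists_isHelicalForm`). The operator is unique because the higher derivatives span the
horizontal space (`IsHelicalForm.operator_unique`).

*Geodesics.* For a covector `ξ` let `J_ξ` be the skew-symmetric operator with
`⟪J_ξ x, y⟫ = ⟪ξ, [x, y]⟫`. Hamilton's equations say that the vertical momentum `l` is constant,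
that `c' = h + [c, h] / 2` and that `h' = J_l h` (`IsBicharacteristic.isReduced`,
`IsReduced.isBicharacteristic`). So the horizontal velocity of a bicharacteristic is
`exp (s J_l) v`, and the rest of `c` is found by integration. Prescribing `J_{l_α} = A_α` when the
bracket is `∑ ⟪A_α x, y⟫ w_α` means that the momenta `l_α` form the basis dual to `w_α`; this is the
correspondence in both directions. The bracket generates `Hᗮ` exactly when the `A_α` are linearly
independent (`linearIndependent_iff_span_operatorBracket`).

*Minimality.* Short arcs of bicharacteristics minimize length because, for a fixed vertical
momentum, the energy minus the momentum term is a quadratic functional of the horizontal curve, and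
its second variation is nonnegative on short intervals. In place of an integration by parts and
a Poincaré inequality, `calibration_deriv_nonneg` is a pointwise estimate which shows that an
explicit function is monotone along any competitor; a time change with rate proportional to the
regularized speed of the competitor turns the energy estimate into the one for lengths
(`IsReduced.energy_le`, `IsReduced.length_le`).
-/

namespace HelicalCarnot

/-! ### Calculus on intervals -/

theorem uniqueDiffOn_interval {J : Set ℝ} (hJ : J.OrdConnected) (hn : J.Nontrivial) :
    UniqueDiffOn ℝ J := by
  obtain ⟨a, ha, b, hb, hab⟩ := hn.exists_lt
  refine uniqueDiffOn_convex hJ.convex ⟨(a + b) / 2, ?_⟩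
  refine interior_mono (hJ.out ha hb) ?_
  rw [interior_Icc]
  constructor <;> linarith

section Calculus

variable {E : Type*} [NormedAddCommGroup E] [NormedSpace ℝ E]

theorem eq_of_hasDerivWithinAt_zero {J : Set ℝ} (hJ : J.OrdConnected) {f : ℝ → E}
    (hf : ∀ s ∈ J, HasDerivWithinAt f 0 J s) {s t : ℝ} (hs : s ∈ J) (ht : t ∈ J) :
    f s = f t := by
  have := hJ.convex.norm_image_sub_le_of_norm_hasDerivWithin_le (C := 0) hf (by simp) ht hs
  rw [zero_mul, norm_le_zero_iff, sub_eq_zero] at this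
  exact this

theorem eqOn_of_hasDerivWithinAt {J : Set ℝ} (hJ : J.OrdConnected) {f g f' : ℝ → E}
    (hf : ∀ s ∈ J, HasDerivWithinAt f (f' s) J s) (hg : ∀ s ∈ J, HasDerivWithinAt g (f' s) J s)
    {s₀ : ℝ} (hs₀ : s₀ ∈ J) (h : f s₀ = g s₀) : EqOn f g J := by
  intro s hs
  have key := eq_of_hasDerivWithinAt_zero hJ (f := fun s => f s - g s)
    (fun s hs => by simpa only [sub_self] using (hf s hs).fun_sub (hg s hs)) hs hs₀
  simpa [h, sub_eq_zero] using key

theorem contDiffOn_of_hasDerivWithinAt {J : Set ℝ} (hJ : UniqueDiffOn ℝ J) {f f' : ℝ → E}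
    (hf : ∀ s ∈ J, HasDerivWithinAt f (f' s) J s) (hf' : ContDiffOn ℝ ∞ f' J) :
    ContDiffOn ℝ ∞ f J := by
  rw [contDiffOn_infty_iff_derivWithin hJ]
  exact ⟨fun s hs => (hf s hs).differentiableWithinAt,
    hf'.congr fun s hs => (hf s hs).derivWithin (hJ s hs)⟩

theorem hasDerivWithinAt_iteratedDerivWithin {J : Set ℝ} (hJ : UniqueDiffOn ℝ J) {f : ℝ → E}
    (hf : ContDiffOn ℝ ∞ f J) (j : ℕ) {s : ℝ} (hs : s ∈ J) :
    HasDerivWithinAt (iteratedDerivWithin j f J) (iteratedDerivWithin (j + 1) f J s) J s := by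
  rw [iteratedDerivWithin_succ]
  exact (hf.differentiableOn_iteratedDerivWithin
    (by exact_mod_cast WithTop.coe_lt_coe.2 (ENat.natCast_lt_top j)) hJ s hs).hasDerivWithinAt

end Calculus

/-! ### One-parameter groups of skew-symmetric operators -/

section Exponential

variable {V : Type*} [NormedAddCommGroup V] [InnerProductSpace ℝ V]

theorem expOp_zero_smul (A : V →L[ℝ] V) (v : V) : expOp ((0 : ℝ) • A) v = v := by
  simp [expOp, NormedSpace.exp_zero]

theorem expOp_comm (A : V →L[ℝ] V) (s : ℝ) (v : V) :
    A (expOp (s • A) v) = expOp (s • A) (A v) := by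
  have h : Commute A (NormedSpace.exp (s • A)) := ((Commute.refl A).smul_right s).exp_right
  exact congrArg (fun B : V →L[ℝ] V => B v) h.eq

theorem pow_expOp_comm (A : V →L[ℝ] V) (s : ℝ) (j : ℕ) (v : V) :
    (A ^ j) (expOp (s • A) v) = expOp (s • A) ((A ^ j) v) := by
  have h : Commute A (NormedSpace.exp (s • A)) := ((Commute.refl A).smul_right s).exp_right
  exact congrArg (fun B : V →L[ℝ] V => B v) (h.pow_left j).eq

theorem inner_apply_self_of_skew {A : V →L[ℝ] V} (hA : ∀ x y : V, ⟪A x, y⟫ = -⟪x, A y⟫) (x : V) :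
    ⟪x, A x⟫ = 0 := by
  have := hA x x
  rw [real_inner_comm] at this
  linarith

theorem norm_eq_of_hasDerivWithinAt_skew {A : V →L[ℝ] V}
    (hA : ∀ x y : V, ⟪A x, y⟫ = -⟪x, A y⟫) {J : Set ℝ} (hJ : J.OrdConnected) {y : ℝ → V}
    (hy : ∀ s ∈ J, HasDerivWithinAt y (A (y s)) J s) {s t : ℝ} (hs : s ∈ J) (ht : t ∈ J) :
    ‖y s‖ = ‖y t‖ := by
  have h := eq_of_hasDerivWithinAt_zero hJ (f := fun s => ⟪y s, y s⟫) (fun s hs => by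
    have := (hy s hs).inner ℝ (hy s hs)
    rwa [real_inner_comm _ (A (y s)), inner_apply_self_of_skew hA, add_zero] at this) hs ht
  simp only [real_inner_self_eq_norm_sq] at h
  exact (sq_eq_sq₀ (norm_nonneg _) (norm_nonneg _)).1 h

variable [CompleteSpace V]

theorem hasDerivAt_expOp (A : V →L[ℝ] V) (v : V) (s : ℝ) :
    HasDerivAt (fun s : ℝ => expOp (s • A) v) (A (expOp (s • A) v)) s := by
  have h := (hasDerivAt_exp_smul_const' (𝕂 := ℝ) A s).clm_apply (hasDerivAt_const s v)
  simpa [expOp] using h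

theorem contDiff_expOp (A : V →L[ℝ] V) (v : V) :
    ContDiff ℝ ∞ (fun s : ℝ => expOp (s • A) v) := by
  have h : ∀ n : ℕ, ContDiff ℝ n (fun s : ℝ => expOp (s • A) v) := by
    intro n
    induction n with
    | zero =>
      exact contDiff_zero.2 <| continuous_iff_continuousAt.2 fun s =>
        (hasDerivAt_expOp A v s).continuousAt
    | succ n ih =>
      rw [Nat.cast_succ, contDiff_succ_iff_deriv]
      refine ⟨fun s => (hasDerivAt_expOp A v s).differentiableAt, by simp, ?_⟩
      rw [show deriv (fun s : ℝ => expOp (s • A) v) = fun s => A (expOp (s • A) v) from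
        funext fun s => (hasDerivAt_expOp A v s).deriv]
      exact A.contDiff.comp ih
  exact contDiff_infty.2 h

theorem expOp_add_smul (A : V →L[ℝ] V) (s t : ℝ) (v : V) :
    expOp ((s + t) • A) v = expOp (s • A) (expOp (t • A) v) := by
  have hc : Commute (s • A) (t • A) := ((Commute.refl A).smul_left s).smul_right t
  let _ : NormedAlgebra ℚ (V →L[ℝ] V) := NormedAlgebra.restrictScalars ℚ ℝ _
  rw [expOp, expOp, expOp, add_smul, NormedSpace.exp_add_of_commute hc]
  rfl

theorem expOp_smul_neg (A : V →L[ℝ] V) (s : ℝ) (v : V) :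
    expOp (s • A) (expOp ((-s) • A) v) = v := by
  rw [← expOp_add_smul, add_neg_cancel, expOp_zero_smul]

theorem norm_expOp_apply {A : V →L[ℝ] V} (hA : ∀ x y : V, ⟪A x, y⟫ = -⟪x, A y⟫) (s : ℝ) (v : V) :
    ‖expOp (s • A) v‖ = ‖v‖ := by
  have := norm_eq_of_hasDerivWithinAt_skew hA (y := fun s : ℝ => expOp (s • A) v)
    (J := univ) ordConnected_univ (fun s _ => (hasDerivAt_expOp A v s).hasDerivWithinAt)
    (mem_univ s) (mem_univ 0)
  rwa [expOp_zero_smul] at this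

theorem exists_eq_expOp_of_hasDerivWithinAt {A : V →L[ℝ] V}
    (hA : ∀ x y : V, ⟪A x, y⟫ = -⟪x, A y⟫) {J : Set ℝ} (hJ : J.OrdConnected) {s₀ : ℝ}
    (hs₀ : s₀ ∈ J) {y : ℝ → V} (hy : ∀ s ∈ J, HasDerivWithinAt y (A (y s)) J s) :
    ∃ v, ∀ s ∈ J, y s = expOp (s • A) v := by
  refine ⟨expOp ((-s₀) • A) (y s₀), fun s hs => ?_⟩
  -- the difference of two solutions solves the equation, so its norm is constant
  have h := norm_eq_of_hasDerivWithinAt_skew hA hJ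
    (y := fun s => y s - expOp (s • A) (expOp ((-s₀) • A) (y s₀)))
    (fun s hs => by
      simpa only [map_sub] using
        (hy s hs).fun_sub (hasDerivAt_expOp A _ s).hasDerivWithinAt) hs hs₀
  simpa only [expOp_smul_neg, sub_self, norm_zero, norm_eq_zero, sub_eq_zero] using h

end Exponential

/-! ### Curves with helical velocity -/

section Helical

variable {d : ℕ} {J : Set ℝ} {μ ν : ℝ → Euc d} {H : Submodule ℝ (Euc d)}

theorem horizontalSpace_congr {w : Euc d}
    (h : ∀ s ∈ J, derivWithin μ J s = w + derivWithin ν J s) :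
    horizontalSpace J μ = horizontalSpace J ν := by
  have key : ∀ j, ∀ s ∈ J,
      iteratedDerivWithin (j + 2) μ J s = iteratedDerivWithin (j + 2) ν J s := by
    intro j s hs
    rw [iteratedDerivWithin_succ' (n := j + 1), iteratedDerivWithin_succ' (n := j + 1),
      iteratedDerivWithin_congr h hs, iteratedDerivWithin_const_add (Nat.succ_pos j)]
  unfold horizontalSpace
  congr 1
  ext x
  constructor <;> rintro ⟨j, hj, s, hs, rfl⟩ <;> obtain ⟨i, rfl⟩ := Nat.exists_eq_add_of_le' hj
  · exact ⟨i + 2, hj, s, hs, key i s hs⟩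
  · exact ⟨i + 2, hj, s, hs, (key i s hs).symm⟩

variable {A A' : H →L[ℝ] H} {v v' : H} {w w' : Hᗮ}

theorem IsHelicalForm.iteratedDerivWithin_eq (hJ : UniqueDiffOn ℝ J)
    (h : IsHelicalForm J μ H A v w) (j : ℕ) : ∀ s ∈ J,
    iteratedDerivWithin (j + 2) μ J s = ((A ^ (j + 1)) (expOp (s • A) v) : H) := by
  induction j with
  | zero =>
    intro s hs
    have hd : HasDerivWithinAt (derivWithin μ J) ((A (expOp (s • A) v) : H) : Euc d) J s := by
      refine HasDerivWithinAt.congr ?_ h.velocity (h.velocity s hs)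
      exact (((H.subtypeL.hasFDerivAt.comp_hasDerivAt s
        (hasDerivAt_expOp A v s)).hasDerivWithinAt).add_const _)
    rw [iteratedDerivWithin_succ, iteratedDerivWithin_one, zero_add, pow_one]
    exact hd.derivWithin (hJ s hs)
  | succ j ih =>
    intro s hs
    have hd : HasDerivWithinAt (iteratedDerivWithin (j + 2) μ J)
        (((A ^ (j + 1)) (A (expOp (s • A) v)) : H) : Euc d) J s := by
      refine HasDerivWithinAt.congr ?_ ih (ih s hs)
      exact ((H.subtypeL ∘L (A ^ (j + 1))).hasFDerivAt.comp_hasDerivAt s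
        (hasDerivAt_expOp A v s)).hasDerivWithinAt
    rw [show j + 1 + 2 = (j + 2) + 1 from rfl, iteratedDerivWithin_succ,
      hd.derivWithin (hJ s hs), pow_succ A (j + 1)]
    rfl

/-- The skew-symmetric operator is determined by the velocity as soon as the higher derivatives
span `H`, because it maps each of them to the next one. -/
theorem IsHelicalForm.operator_unique (hJ : UniqueDiffOn ℝ J) (hH : horizontalSpace J μ = H)
    (h : IsHelicalForm J μ H A v w) (h' : IsHelicalForm J μ H A' v' w') : A = A' := by
  have hle : horizontalSpace J μ ≤
      (LinearMap.eqLocus (A : H →ₗ[ℝ] H) (A' : H →ₗ[ℝ] H)).map H.subtype := by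
    refine span_le.2 ?_
    rintro x ⟨j, hj, s, hs, rfl⟩
    obtain ⟨i, rfl⟩ := Nat.exists_eq_add_of_le' hj
    refine ⟨(A ^ (i + 1)) (expOp (s • A) v), ?_, (h.iteratedDerivWithin_eq hJ i s hs).symm⟩
    have e : (A ^ (i + 1)) (expOp (s • A) v) = (A' ^ (i + 1)) (expOp (s • A') v') :=
      Subtype.ext ((h.iteratedDerivWithin_eq hJ i s hs).symm.trans
        (h'.iteratedDerivWithin_eq hJ i s hs))
    have e' : (A ^ (i + 1 + 1)) (expOp (s • A) v) = (A' ^ (i + 1 + 1)) (expOp (s • A') v') :=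
      Subtype.ext ((h.iteratedDerivWithin_eq hJ (i + 1) s hs).symm.trans
        (h'.iteratedDerivWithin_eq hJ (i + 1) s hs))
    rw [pow_succ' A, pow_succ' A'] at e'
    change A ((A ^ (i + 1)) (expOp (s • A) v)) = A' ((A ^ (i + 1)) (expOp (s • A) v))
    calc A ((A ^ (i + 1)) (expOp (s • A) v)) = A' ((A' ^ (i + 1)) (expOp (s • A') v')) := e'
      _ = _ := by rw [e]
  ext x : 1
  obtain ⟨y, hy, hyx⟩ := hle (hH.symm ▸ x.2 : (x : Euc d) ∈ horizontalSpace J μ)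
  obtain rfl : y = x := Subtype.ext hyx
  exact hy

theorem IsHelicalForm.starProjection_derivWithin (h : IsHelicalForm J μ H A v w) {s : ℝ}
    (hs : s ∈ J) : Hᗮ.starProjection (derivWithin μ J s) = w := by
  rw [h.velocity s hs, map_add, starProjection_eq_self_iff.2 w.2,
    (starProjection_apply_eq_zero_iff _).2, zero_add]
  exact le_orthogonal_orthogonal H (SetLike.coe_mem _)

theorem IsHelicalForm.isQ (hJ : UniqueDiffOn ℝ J) (h : IsHelicalForm J μ H A v w)
    (hμ : DifferentiableOn ℝ μ J) : IsQ 1 J μ where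
  smooth := by
    refine contDiffOn_of_hasDerivWithinAt hJ (fun s hs => (hμ s hs).hasDerivWithinAt) ?_
    refine ContDiffOn.congr ?_ h.velocity
    exact ((H.subtypeL.contDiff.comp (contDiff_expOp A v)).add contDiff_const).contDiffOn
  norm_const := by
    intro j hj
    obtain ⟨i, rfl⟩ := Nat.exists_eq_add_of_le' hj
    rcases i with _ | i
    · refine ⟨√(‖v‖ ^ 2 + ‖w‖ ^ 2), fun s hs => ?_⟩
      rw [zero_add, iteratedDerivWithin_one, h.velocity s hs, eq_comm,
        Real.sqrt_eq_iff_mul_self_eq (by positivity) (norm_nonneg _),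
        norm_add_sq_eq_norm_sq_add_norm_sq_real, norm_coe, norm_coe, norm_expOp_apply h.skew]
      · ring
      · exact w.2 _ (SetLike.coe_mem _)
    · refine ⟨‖(A ^ (i + 1)) v‖, fun s hs => ?_⟩
      rw [add_assoc, h.iteratedDerivWithin_eq hJ i s hs, norm_coe, pow_expOp_comm,
        norm_expOp_apply h.skew]

end Helical

/-! ### The operator of a curve with constant derivative norms -/

section Gram

variable {E : Type*} [NormedAddCommGroup E] [InnerProductSpace ℝ E]

/-- The value at time `s` of the constant-coefficient differential operator `P` applied to a curve
whose `j`-th derivative is `γ j`. -/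
noncomputable abbrev diffOp (γ : ℕ → ℝ → E) (s : ℝ) : (ℕ →₀ ℝ) →ₗ[ℝ] E :=
  Finsupp.linearCombination ℝ (fun j => γ j s)

/-- Composition of a constant-coefficient differential operator with `d/ds`. -/
noncomputable abbrev shift : (ℕ →₀ ℝ) →ₗ[ℝ] (ℕ →₀ ℝ) := Finsupp.lmapDomain ℝ ℝ Nat.succ

theorem diffOp_single (γ : ℕ → ℝ → E) (s : ℝ) (j : ℕ) (a : ℝ) :
    diffOp γ s (Finsupp.single j a) = a • γ j s := by simp [diffOp]

theorem shift_single (j : ℕ) (a : ℝ) :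
    shift (Finsupp.single j a) = Finsupp.single (j + 1) a := by simp [shift]

/-- The family `γ` consists of the derivatives of `γ 0` on `J`, and they have constant norms. -/
structure IsConstNormFamily (J : Set ℝ) (γ : ℕ → ℝ → E) : Prop where
  deriv : ∀ j, ∀ s ∈ J, HasDerivWithinAt (γ j) (γ (j + 1) s) J s
  norm_eq : ∀ j, ∀ s ∈ J, ∀ t ∈ J, ‖γ j s‖ = ‖γ j t‖

namespace IsConstNormFamily

variable {J : Set ℝ} {γ : ℕ → ℝ → E}

theorem hasDerivWithinAt_diffOp (h : IsConstNormFamily J γ) (P : ℕ →₀ ℝ) {s : ℝ} (hs : s ∈ J) :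
    HasDerivWithinAt (fun s => diffOp γ s P) (diffOp γ s (shift P)) J s := by
  induction P using Finsupp.induction_linear with
  | zero => simpa using hasDerivWithinAt_const s J (0 : E)
  | add P Q hP hQ => simpa only [map_add] using hP.fun_add hQ
  | single j a =>
    simpa only [diffOp_single, shift_single] using (h.deriv j s hs).fun_const_smul a

/-- The Gram matrix of the derivatives is constant. Differentiating the constant
`⟪γ i, γ (i + k + 1)⟫` expresses the products at distance `k + 2` through those at distance `k`. -/
theorem inner_eq (h : IsConstNormFamily J γ) (hJ' : UniqueDiffOn ℝ J)
    (k : ℕ) : ∀ i, ∀ s ∈ J, ∀ t ∈ J, ⟪γ i s, γ (i + k) s⟫ = ⟪γ i t, γ (i + k) t⟫ := by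
  -- the derivative of a constant inner product vanishes
  have hzero : ∀ i j, (∀ s ∈ J, ∀ t ∈ J, ⟪γ i s, γ j s⟫ = ⟪γ i t, γ j t⟫) →
      ∀ s ∈ J, ⟪γ i s, γ (j + 1) s⟫ + ⟪γ (i + 1) s, γ j s⟫ = 0 := by
    intro i j hc s hs
    have h1 := (h.deriv i s hs).inner ℝ (h.deriv j s hs)
    have h2 : HasDerivWithinAt (fun t => ⟪γ i t, γ j t⟫) 0 J s :=
      (hasDerivWithinAt_const s J ⟪γ i s, γ j s⟫).congr (fun t ht => hc t ht s hs) rfl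
    exact (hJ' s hs).eq_deriv _ h1 h2
  induction k using Nat.twoStepInduction with
  | zero =>
    intro i s hs t ht
    rw [add_zero, real_inner_self_eq_norm_sq, real_inner_self_eq_norm_sq, h.norm_eq i s hs t ht]
  | one =>
    have : ∀ i, ∀ s ∈ J, ⟪γ i s, γ (i + 1) s⟫ = 0 := by
      intro i s hs
      have := hzero i i (fun s hs t ht => by
        rw [real_inner_self_eq_norm_sq, real_inner_self_eq_norm_sq, h.norm_eq i s hs t ht]) s hs
      rw [real_inner_comm] at this ⊢
      linarith
    intro i s hs t ht
    rw [this i s hs, this i t ht]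
  | more k ih0 ih1 =>
    intro i s hs t ht
    have h1 := hzero i (i + (k + 1)) (ih1 i) s hs
    have h2 := hzero i (i + (k + 1)) (ih1 i) t ht
    have h3 := ih0 (i + 1) s hs t ht
    rw [show i + 1 + k = i + (k + 1) by ring] at h3
    rw [show i + (k + 1) + 1 = i + (k + 2) by ring] at h1 h2
    linarith

theorem inner_diffOp_eq (h : IsConstNormFamily J γ) (hJ' : UniqueDiffOn ℝ J)
    (P Q : ℕ →₀ ℝ) {s t : ℝ} (hs : s ∈ J) (ht : t ∈ J) :
    ⟪diffOp γ s P, diffOp γ s Q⟫ = ⟪diffOp γ t P, diffOp γ t Q⟫ := by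
  induction P using Finsupp.induction_linear with
  | zero => simp
  | add P P' hP hP' => simp only [map_add, inner_add_left, hP, hP']
  | single i a =>
    induction Q using Finsupp.induction_linear with
    | zero => simp
    | add Q Q' hQ hQ' => simp only [map_add, inner_add_right, hQ, hQ']
    | single j b =>
      simp only [diffOp_single, inner_smul_left, inner_smul_right]
      rcases le_total i j with hij | hij
      · obtain ⟨k, rfl⟩ := Nat.exists_eq_add_of_le hij
        rw [h.inner_eq hJ' k i s hs t ht]
      · obtain ⟨k, rfl⟩ := Nat.exists_eq_add_of_le hij
        rw [real_inner_comm, h.inner_eq hJ' k j s hs t ht, real_inner_comm]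

theorem inner_diffOp_shift (h : IsConstNormFamily J γ) (hJ' : UniqueDiffOn ℝ J)
    (P Q : ℕ →₀ ℝ) {s : ℝ} (hs : s ∈ J) :
    ⟪diffOp γ s (shift P), diffOp γ s Q⟫ = -⟪diffOp γ s P, diffOp γ s (shift Q)⟫ := by
  have h1 := (h.hasDerivWithinAt_diffOp P hs).inner ℝ (h.hasDerivWithinAt_diffOp Q hs)
  have h2 : HasDerivWithinAt (fun t => ⟪diffOp γ t P, diffOp γ t Q⟫) 0 J s :=
    (hasDerivWithinAt_const s J ⟪diffOp γ s P, diffOp γ s Q⟫).congr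
      (fun t ht => h.inner_diffOp_eq hJ' P Q ht hs) rfl
  have := (hJ' s hs).eq_deriv _ h1 h2
  linarith

theorem diffOp_eq_zero (h : IsConstNormFamily J γ) (hJ' : UniqueDiffOn ℝ J)
    {P : ℕ →₀ ℝ} {s t : ℝ} (hs : s ∈ J) (ht : t ∈ J)
    (hP : diffOp γ s P = 0) : diffOp γ t P = 0 := by
  rw [← inner_self_eq_zero (𝕜 := ℝ), ← h.inner_diffOp_eq hJ' P P hs ht, hP, inner_zero_left]

/-- A relation between derivatives can be differentiated. -/
theorem diffOp_shift_eq_zero (h : IsConstNormFamily J γ) (hJ' : UniqueDiffOn ℝ J)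
    {P : ℕ →₀ ℝ} {s : ℝ} (hs : s ∈ J)
    (hP : diffOp γ s P = 0) : diffOp γ s (shift P) = 0 := by
  have h2 : HasDerivWithinAt (fun t => diffOp γ t P) 0 J s :=
    (hasDerivWithinAt_const s J (0 : E)).congr
      (fun t ht => h.diffOp_eq_zero hJ' hs ht hP) hP
  exact (hJ' s hs).eq_deriv _ (h.hasDerivWithinAt_diffOp P hs) h2

theorem tail (h : IsConstNormFamily J γ) : IsConstNormFamily J (fun j => γ (j + 1)) :=
  ⟨fun j => h.deriv (j + 1), fun j => h.norm_eq (j + 1)⟩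

theorem diffOp_tail (γ : ℕ → ℝ → E) (s : ℝ) (P : ℕ →₀ ℝ) :
    diffOp (fun j => γ (j + 1)) s P = diffOp γ s (shift P) := by
  induction P using Finsupp.induction_linear with
  | zero => simp
  | add P Q hP hQ => simp only [map_add, hP, hQ]
  | single j a => rw [diffOp_single, shift_single, diffOp_single]

variable [FiniteDimensional ℝ E]

/-- The derivatives evolve by a one-parameter group of isometries of the span of their values at
one time: the generator `T` maps each derivative to the next one. -/
theorem exists_generator (h : IsConstNormFamily J γ) (hJ : J.OrdConnected)
    (hJ' : UniqueDiffOn ℝ J) {s₀ : ℝ} (hs₀ : s₀ ∈ J) {W : Submodule ℝ E}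
    (hW : W = LinearMap.range (diffOp γ s₀)) :
    ∃ T : W →L[ℝ] W, (∀ x y : W, ⟪T x, y⟫ = -⟪x, T y⟫) ∧
      ∀ P, ∀ s ∈ J, ∃ hs : diffOp γ s P ∈ W,
        ((T ⟨diffOp γ s P, hs⟩ : W) : E) = diffOp γ s (shift P) := by
  have hmem : ∀ P, diffOp γ s₀ P ∈ W := fun P => hW ▸ LinearMap.mem_range_self _ P
  set Φ : (ℕ →₀ ℝ) →ₗ[ℝ] W := (diffOp γ s₀).codRestrict W hmem
  have hsurj : LinearMap.range Φ = ⊤ := by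
    refine LinearMap.range_eq_top.2 ?_
    rintro ⟨x, hx⟩
    rw [hW] at hx
    obtain ⟨P, hP⟩ := hx
    exact ⟨P, Subtype.ext hP⟩
  obtain ⟨R, hR⟩ := Φ.exists_rightInverse_of_surjective hsurj
  have hR' : ∀ x, Φ (R x) = x := fun x => congrArg (fun f : W →ₗ[ℝ] W => f x) hR
  -- relations at time `s₀` hold at all times
  have hrel : ∀ P Q, Φ P = Φ Q → ∀ s ∈ J, diffOp γ s P = diffOp γ s Q := by
    intro P Q hPQ s hs
    have : diffOp γ s₀ (P - Q) = 0 := by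
      rw [map_sub, sub_eq_zero]; exact congrArg Subtype.val hPQ
    have := h.diffOp_eq_zero hJ' hs₀ hs this
    rwa [map_sub, sub_eq_zero] at this
  set T : W →L[ℝ] W := LinearMap.toContinuousLinearMap (Φ ∘ₗ shift ∘ₗ R)
  have hTdef : ∀ x, T x = Φ (shift (R x)) := fun x => rfl
  have hTΦ : ∀ P, T (Φ P) = Φ (shift P) := by
    intro P
    have : diffOp γ s₀ (R (Φ P) - P) = 0 := by
      rw [map_sub, sub_eq_zero]; exact congrArg Subtype.val (hR' (Φ P))
    have := h.diffOp_shift_eq_zero hJ' hs₀ this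
    rw [map_sub, map_sub, sub_eq_zero] at this
    exact Subtype.ext this
  have hskew : ∀ x y : W, ⟪T x, y⟫ = -⟪x, T y⟫ := by
    intro x y
    obtain ⟨P, rfl⟩ : ∃ P, Φ P = x := ⟨R x, hR' x⟩
    obtain ⟨Q, rfl⟩ : ∃ Q, Φ Q = y := ⟨R y, hR' y⟩
    rw [hTΦ, hTΦ]
    exact h.inner_diffOp_shift hJ' P Q hs₀
  -- transport of `W` from time `s₀` to time `s`
  have hflow : ∀ y : ℝ → W, (∀ s ∈ J, HasDerivWithinAt y (-T (y s)) J s) →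
      ∀ s ∈ J, diffOp γ s (R (y s)) = y s₀ := by
    intro y hy s hs
    let b := Module.finBasis ℝ W
    let c : Fin (Module.finrank ℝ W) → W →L[ℝ] ℝ := fun i =>
      LinearMap.toContinuousLinearMap (b.coord i)
    have hexp : ∀ (L : W →ₗ[ℝ] E) (x : W), L x = ∑ i, c i x • L (b i) := by
      intro L x
      have := congrArg L (b.sum_repr x)
      rw [map_sum] at this
      exact this.symm.trans (Finset.sum_congr rfl fun i _ => L.map_smul _ _)
    have hd : ∀ t ∈ J, HasDerivWithinAt (fun t => diffOp γ t (R (y t))) 0 J t := by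
      intro t ht
      have h1 : HasDerivWithinAt (fun t => ∑ i, c i (y t) • (diffOp γ t ∘ₗ R) (b i))
          (∑ i, (c i (y t) • (diffOp γ t ∘ₗ shift ∘ₗ R) (b i) +
            c i (-T (y t)) • (diffOp γ t ∘ₗ R) (b i))) J t := by
        refine HasDerivWithinAt.fun_sum fun i _ => ?_
        exact ((c i).hasFDerivAt.comp_hasDerivWithinAt t (hy t ht)).fun_smul
          (h.hasDerivWithinAt_diffOp (R (b i)) ht)
      rw [Finset.sum_add_distrib, ← hexp, ← hexp] at h1
      have h4 : diffOp γ t (R (T (y t))) = diffOp γ t (shift (R (y t))) :=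
        hrel _ _ (by rw [hR', hTdef]) t ht
      rw [map_neg, LinearMap.comp_apply, LinearMap.comp_apply, LinearMap.comp_apply, h4,
        add_neg_cancel] at h1
      exact h1.congr (fun t _ => hexp (diffOp γ t ∘ₗ R) (y t)) (hexp (diffOp γ t ∘ₗ R) (y t))
    rw [eq_of_hasDerivWithinAt_zero hJ hd hs hs₀]
    exact congrArg Subtype.val (hR' (y s₀))
  have hform : ∀ P, ∀ s ∈ J, diffOp γ s P = expOp ((s - s₀) • T) (Φ P) := by
    intro P s hs
    have hy : ∀ t ∈ J, HasDerivWithinAt (fun t => expOp ((s - t) • T) (Φ P))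
        (-T (expOp ((s - t) • T) (Φ P))) J t := by
      intro t _
      have := (hasDerivAt_expOp T (Φ P) (s - t)).scomp t ((hasDerivAt_id t).const_sub s)
      simpa [Function.comp_def] using this.hasDerivWithinAt
    have := hflow _ hy s hs
    rw [sub_self, expOp_zero_smul] at this
    rw [← this]
    exact (hrel _ _ (hR' (Φ P)) s hs).symm
  refine ⟨T, hskew, fun P s hs => ⟨?_, ?_⟩⟩
  · rw [hform P s hs]; exact SetLike.coe_mem _
  · have : (⟨diffOp γ s P, by rw [hform P s hs]; exact SetLike.coe_mem _⟩ : W) =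
        expOp ((s - s₀) • T) (Φ P) := Subtype.ext (hform P s hs)
    rw [this, expOp_comm, hTΦ, ← hform _ s hs]

end IsConstNormFamily

end Gram

section Existence

variable {d : ℕ} {J : Set ℝ} {μ : ℝ → Euc d} {H : Submodule ℝ (Euc d)}

theorem IsQ.isConstNormFamily (hJ : UniqueDiffOn ℝ J) (hμ : IsQ 1 J μ) :
    IsConstNormFamily J (fun j => iteratedDerivWithin (j + 1) μ J) where
  deriv j s hs := hasDerivWithinAt_iteratedDerivWithin hJ hμ.smooth (j + 1) hs
  norm_eq j s hs t ht := by
    obtain ⟨r, hr⟩ := hμ.norm_const (j + 1) (Nat.le_add_left 1 j)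
    rw [hr s hs, hr t ht]

/-- A curve in `Q_1` has helical velocity, with an invertible operator on its horizontal space.
Injectivity of the generator on the span of the derivatives of order `≥ 2` comes from one more
integration by parts, against a derivative of order `≥ 1`. -/
theorem IsQ.exists_isHelicalForm (hJ : J.OrdConnected) (hJn : J.Nontrivial) (hμ : IsQ 1 J μ)
    (hH : horizontalSpace J μ = H) :
    ∃ A : H →L[ℝ] H, Function.Bijective A ∧ ∃ v w, IsHelicalForm J μ H A v w := by
  have hJ' := uniqueDiffOn_interval hJ hJn
  obtain ⟨s₀, hs₀⟩ := hJn.nonempty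
  set γ : ℕ → ℝ → Euc d := fun j => iteratedDerivWithin (j + 1) μ J with hγ
  have h : IsConstNormFamily J γ := hμ.isConstNormFamily hJ'
  obtain ⟨T₀, -, hTs₀⟩ := h.tail.exists_generator hJ hJ' hs₀ rfl
  -- the span at one time is the horizontal space, since the flow preserves it
  have hHr : H = LinearMap.range (diffOp (fun j => γ (j + 1)) s₀) := by
    rw [← hH]
    apply le_antisymm
    · refine span_le.2 ?_
      rintro x ⟨j, hj, s, hs, rfl⟩
      obtain ⟨i, rfl⟩ := Nat.exists_eq_add_of_le' hj
      obtain ⟨hm, -⟩ := hTs₀ (Finsupp.single i 1) s hs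
      simpa [diffOp_single, hγ] using hm
    · rintro x ⟨P, rfl⟩
      rw [diffOp, Finsupp.linearCombination_apply]
      exact Submodule.sum_mem _ fun j _ => Submodule.smul_mem _ _
        (subset_span ⟨j + 2, by omega, s₀, hs₀, rfl⟩)
  obtain ⟨T, hT, hTs⟩ := h.tail.exists_generator hJ hJ' hs₀ hHr
  simp only [IsConstNormFamily.diffOp_tail] at hTs
  have hrange : ∀ x : H, ∃ P, diffOp γ s₀ (shift P) = x := by
    intro x
    obtain ⟨P, hP⟩ : (x : Euc d) ∈ LinearMap.range (diffOp (fun j => γ (j + 1)) s₀) :=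
      hHr.le x.2
    exact ⟨P, by rw [← IsConstNormFamily.diffOp_tail, hP]⟩
  have hinj : Function.Injective T := by
    refine (injective_iff_map_eq_zero T).2 fun x hx => ?_
    obtain ⟨P, hP⟩ := hrange x
    obtain ⟨hm, hTP⟩ := hTs P s₀ hs₀
    have hx' : (⟨diffOp γ s₀ (shift P), hm⟩ : H) = x := Subtype.ext hP
    rw [hx', hx] at hTP
    have h1 := h.inner_diffOp_shift hJ' (shift P) P hs₀
    rw [← hTP, hP] at h1
    refine Subtype.ext (inner_self_eq_zero (𝕜 := ℝ).1 ?_)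
    simpa using h1
  have hbij : Function.Bijective T :=
    ⟨hinj, LinearMap.surjective_of_injective (f := (T : H →ₗ[ℝ] H)) hinj⟩
  -- the second derivative solves the linear equation with operator `T`
  obtain ⟨v₀, hv₀⟩ : ∃ v₀ : H, ∀ s ∈ J, γ 1 s = expOp (s • T) v₀ := by
    have hm : ∀ s ∈ J, γ 1 s ∈ H := fun s hs => by
      obtain ⟨hm, -⟩ := hTs (Finsupp.single 0 1) s hs
      simpa [diffOp_single] using hm
    set y : ℝ → H := fun s => H.orthogonalProjectionOnto (γ 1 s) with hy
    have hyγ : ∀ s ∈ J, ((y s : H) : Euc d) = γ 1 s := fun s hs =>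
      starProjection_eq_self_iff.2 (hm s hs)
    obtain ⟨v₀, hv₀⟩ := exists_eq_expOp_of_hasDerivWithinAt hT hJ hs₀ (y := y) (by
      intro s hs
      have h1 := H.orthogonalProjectionOnto.hasFDerivAt.comp_hasDerivWithinAt s (h.deriv 1 s hs)
      have h2 : H.orthogonalProjectionOnto (γ (1 + 1) s) = T (y s) := by
        obtain ⟨hm', hTP⟩ := hTs (Finsupp.single 0 1) s hs
        have e : (⟨_, hm'⟩ : H) = y s := Subtype.ext (by
          rw [hyγ s hs]; simp)
        rw [e, shift_single, shift_single, diffOp_single, one_smul] at hTP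
        rw [← orthogonalProjectionOnto_mem_subspace_eq_self (T (y s)), hTP]
      rwa [h2] at h1)
    exact ⟨v₀, fun s hs => by rw [← hyγ s hs, hv₀ s hs]⟩
  obtain ⟨v, rfl⟩ := hbij.2 v₀
  -- hence the velocity is a solution of that equation up to a constant `w`
  set w : Euc d := γ 0 s₀ - expOp (s₀ • T) v with hw
  have hvel : ∀ s ∈ J, γ 0 s = expOp (s • T) v + w := by
    refine eqOn_of_hasDerivWithinAt hJ (f' := γ 1) (h.deriv 0) (fun s hs => ?_) hs₀
      (by rw [hw]; abel)
    rw [hv₀ s hs, ← expOp_comm]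
    exact ((H.subtypeL.hasFDerivAt.comp_hasDerivAt s
      (hasDerivAt_expOp T v s)).hasDerivWithinAt).add_const _
  have hwH : w ∈ Hᗮ := by
    intro x hx
    obtain ⟨x', hx'⟩ := hbij.2 ⟨x, hx⟩
    obtain ⟨P, hP⟩ := hrange x'
    obtain ⟨hm, hTP⟩ := hTs P s₀ hs₀
    have e : (⟨_, hm⟩ : H) = x' := Subtype.ext hP
    rw [e, hx'] at hTP
    have h1 := h.inner_diffOp_shift hJ' (shift P) (Finsupp.single 0 1) hs₀
    rw [← hTP, shift_single, diffOp_single, diffOp_single, one_smul, one_smul, hP, zero_add,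
      hv₀ s₀ hs₀, ← expOp_comm] at h1
    have h2 := hT x' (expOp (s₀ • T) v)
    rw [hx'] at h2
    rw [hw, inner_sub_right, sub_eq_zero]
    exact h1.trans h2.symm
  refine ⟨T, hbij, v, ⟨w, hwH⟩, hT, fun s hs => ?_⟩
  rw [← iteratedDerivWithin_one]
  exact hvel s hs

end Existence

namespace StratifiedLieAlgebra

variable {d : ℕ} (g : StratifiedLieAlgebra d)

/-! ### Hamilton's equations on a step-two Carnot group -/

theorem bracket_symm (x y : Euc d) : g.bracket x y = -g.bracket y x := by
  have h := g.bracket_self (x + y)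
  simp only [map_add, LinearMap.add_apply, g.bracket_self, zero_add, add_zero] at h
  exact eq_neg_of_add_eq_zero_right h

theorem bracket_π₁_right (x y : Euc d) : g.bracket x (g.π₁ y) = g.bracket x y := by
  have := g.central x _ (sub_starProjection_mem_orthogonal (K := g.V₁) y)
  rw [map_sub, sub_eq_zero] at this
  exact this.symm

theorem bracket_π₁_left (x y : Euc d) : g.bracket (g.π₁ x) y = g.bracket x y := by
  rw [bracket_symm, bracket_π₁_right, ← bracket_symm]

theorem π₁_bracket (x y : Euc d) : g.π₁ (g.bracket x y) = 0 :=
  (starProjection_apply_eq_zero_iff _).2 (g.bracket_mem x y)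

theorem π₁_of_mem {x : Euc d} (hx : x ∈ g.V₁) : g.π₁ x = x := starProjection_eq_self_iff.2 hx

theorem π₁_leftInvariant {v : Euc d} (hv : v ∈ g.V₁) (x : Euc d) :
    g.π₁ (g.leftInvariant v x) = v := by
  rw [leftInvariant, map_add, map_smul, π₁_bracket, smul_zero, add_zero, π₁_of_mem g hv]

theorem π₁_add_π₂ (x : Euc d) : g.π₁ x + g.π₂ x = x :=
  starProjection_add_starProjection_orthogonal x

/-- The operator `J_ξ` of the covector `ξ`, given by `⟪J_ξ x, y⟫ = ⟪ξ, [x, y]⟫`. -/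
noncomputable def momentumOp (ξ : Euc d) : Euc d →L[ℝ] Euc d :=
  LinearMap.toContinuousLinearMap
    { toFun := fun x => LinearMap.adjoint (g.bracket x) ξ
      map_add' := fun x y => by simp
      map_smul' := fun a x => by simp }

theorem inner_momentumOp (ξ x y : Euc d) : ⟪g.momentumOp ξ x, y⟫ = ⟪ξ, g.bracket x y⟫ := by
  change ⟪LinearMap.adjoint (g.bracket x) ξ, y⟫ = _
  exact LinearMap.adjoint_inner_left (g.bracket x) y ξ

theorem momentumOp_skew (ξ x y : Euc d) : ⟪g.momentumOp ξ x, y⟫ = -⟪x, g.momentumOp ξ y⟫ := by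
  rw [inner_momentumOp, ← real_inner_comm x, inner_momentumOp, bracket_symm, inner_neg_right]

theorem momentumOp_mem (ξ x : Euc d) : g.momentumOp ξ x ∈ g.V₁ := by
  rw [← orthogonal_orthogonal g.V₁]
  intro y hy
  rw [real_inner_comm, inner_momentumOp, g.central x y hy, inner_zero_right]

theorem momentumOp_π₁ (ξ x : Euc d) : g.momentumOp ξ (g.π₁ x) = g.momentumOp ξ x := by
  refine ext_inner_right ℝ fun y => ?_
  rw [inner_momentumOp, bracket_π₁_left, inner_momentumOp]

theorem momentumOp_π₂ (ξ : Euc d) : g.momentumOp (g.π₂ ξ) = g.momentumOp ξ := by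
  ext x : 1
  refine ext_inner_right ℝ fun y => ?_
  rw [inner_momentumOp, inner_momentumOp, inner_starProjection_left_eq_right,
    starProjection_eq_self_iff.2 (g.bracket_mem x y)]

theorem momentumOp_leftInvariant (ξ v x : Euc d) :
    g.momentumOp ξ (g.leftInvariant v x) = g.momentumOp ξ v := by
  rw [← momentumOp_π₁, leftInvariant, map_add, map_smul, π₁_bracket, smul_zero, add_zero,
    momentumOp_π₁]

/-- The vector in `V₁` representing the restriction of the covector `ξ` at `x` to the horizontal
distribution, which is trivialized by the left-invariant fields. -/
noncomputable def horizontalMomentum (x ξ : Euc d) : Euc d :=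
  g.π₁ ξ + (1 / 2 : ℝ) • g.momentumOp ξ x

theorem horizontalMomentum_mem (x ξ : Euc d) : g.horizontalMomentum x ξ ∈ g.V₁ :=
  g.V₁.add_mem (starProjection_apply_mem _ _) (g.V₁.smul_mem _ (g.momentumOp_mem _ _))

theorem inner_leftInvariant {v : Euc d} (hv : v ∈ g.V₁) (x ξ : Euc d) :
    ⟪ξ, g.leftInvariant v x⟫ = ⟪g.horizontalMomentum x ξ, v⟫ := by
  rw [leftInvariant, horizontalMomentum, inner_add_right, inner_smul_right, inner_add_left,
    inner_smul_left, inner_momentumOp, inner_starProjection_left_eq_right, g.π₁_of_mem hv]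
  rfl

theorem hamiltonian_eq (x ξ : Euc d) :
    g.hamiltonian x ξ = (1 / 2) * ‖g.horizontalMomentum x ξ‖ ^ 2 := by
  have h := (stdOrthonormalBasis ℝ g.V₁).sum_sq_norm_inner_left
    ⟨_, g.horizontalMomentum_mem x ξ⟩
  rw [← norm_coe] at h
  rw [hamiltonian, ← h]
  congr 1
  refine Finset.sum_congr rfl fun i _ => ?_
  rw [g.inner_leftInvariant (SetLike.coe_mem _), Real.norm_eq_abs, sq_abs]
  rfl

theorem hasGradientAt_hamiltonian_momentum (x ξ : Euc d) :
    HasGradientAt (fun η => g.hamiltonian x η)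
      (g.leftInvariant (g.horizontalMomentum x ξ) x) ξ := by
  let L : Euc d →L[ℝ] Euc d := g.π₁ +
    (1 / 2 : ℝ) • LinearMap.toContinuousLinearMap (LinearMap.adjoint (g.bracket x))
  have hL : ∀ η, L η = g.horizontalMomentum x η := fun η => rfl
  have h := (L.hasFDerivAt (x := ξ)).norm_sq.const_mul (1 / 2)
  simp only [hL, ← hamiltonian_eq] at h
  refine hasGradientAt_iff_hasFDerivAt.2 (h.congr_fderiv ?_)
  ext δ
  simp only [smul_apply, ContinuousLinearMap.comp_apply, innerSL_apply_apply,
    InnerProductSpace.toDual_apply_apply, hL, smul_eq_mul, nsmul_eq_mul]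
  rw [real_inner_comm δ (g.leftInvariant _ _),
    g.inner_leftInvariant (g.horizontalMomentum_mem x ξ), real_inner_comm]
  push_cast
  ring

theorem hasGradientAt_hamiltonian_position (x ξ : Euc d) :
    HasGradientAt (fun y => g.hamiltonian y ξ)
      (-((1 / 2 : ℝ) • g.momentumOp ξ (g.horizontalMomentum x ξ))) x := by
  have h0 : HasFDerivAt (fun y => g.horizontalMomentum y ξ) ((1 / 2 : ℝ) • g.momentumOp ξ) x :=
    (((1 / 2 : ℝ) • g.momentumOp ξ).hasFDerivAt).const_add _
  have h := h0.norm_sq.const_mul (1 / 2)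
  simp only [← hamiltonian_eq] at h
  refine hasGradientAt_iff_hasFDerivAt.2 (h.congr_fderiv ?_)
  ext δ
  simp only [smul_apply, ContinuousLinearMap.comp_apply, innerSL_apply_apply,
    InnerProductSpace.toDual_apply_apply, smul_eq_mul, nsmul_eq_mul, inner_neg_left,
    inner_smul_left, inner_smul_right, momentumOp_skew g ξ (g.horizontalMomentum x ξ)]
  simp

/-- The reduced form of Hamilton's equations: the curve `c` has the horizontal velocity `h`, in the
trivialization by left-invariant fields, and `h` solves `h' = J_l h`. -/
structure IsReduced (J : Set ℝ) (l : Euc d) (c h : ℝ → Euc d) : Prop where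
  mem : ∀ s ∈ J, h s ∈ g.V₁
  position : ∀ s ∈ J, HasDerivWithinAt c (g.leftInvariant (h s) (c s)) J s
  velocity : ∀ s ∈ J, HasDerivWithinAt h (g.momentumOp l (h s)) J s

variable {g} {J : Set ℝ} {c ξ h : ℝ → Euc d} {l : Euc d}

theorem IsBicharacteristic.isReduced (hJ : J.OrdConnected) {s₀ : ℝ} (hs₀ : s₀ ∈ J)
    (hc : g.IsBicharacteristic J c ξ) :
    g.IsReduced J (g.π₂ (ξ s₀)) c (fun s => g.horizontalMomentum (c s) (ξ s)) := by
  have hpos : ∀ s ∈ J, HasDerivWithinAt c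
      (g.leftInvariant (g.horizontalMomentum (c s) (ξ s)) (c s)) J s := by
    intro s hs
    have := hc.position s hs
    rwa [(g.hasGradientAt_hamiltonian_momentum (c s) (ξ s)).gradient] at this
  have hmom : ∀ s ∈ J, HasDerivWithinAt ξ
      ((1 / 2 : ℝ) • g.momentumOp (ξ s) (g.horizontalMomentum (c s) (ξ s))) J s := by
    intro s hs
    have := hc.momentum s hs
    rwa [(g.hasGradientAt_hamiltonian_position (c s) (ξ s)).gradient, neg_neg] at this
  have hconst : ∀ s ∈ J, g.π₂ (ξ s) = g.π₂ (ξ s₀) := by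
    intro s hs
    refine eq_of_hasDerivWithinAt_zero hJ (f := fun s => g.π₂ (ξ s)) (fun s hs => ?_) hs hs₀
    have h1 := g.π₂.hasFDerivAt.comp_hasDerivWithinAt s (hmom s hs)
    rwa [map_smul, (starProjection_apply_eq_zero_iff _).2
      (le_orthogonal_orthogonal g.V₁ (g.momentumOp_mem _ _)), smul_zero] at h1
  have hop : ∀ s ∈ J, g.momentumOp (ξ s) = g.momentumOp (g.π₂ (ξ s₀)) := fun s hs => by
    rw [← momentumOp_π₂, hconst s hs]
  refine ⟨fun s _ => g.horizontalMomentum_mem _ _, hpos, fun s hs => ?_⟩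
  have h1 : HasDerivWithinAt (fun s => g.π₁ (ξ s) + (1 / 2 : ℝ) • g.momentumOp (g.π₂ (ξ s₀)) (c s))
      _ J s := (g.π₁.hasFDerivAt.comp_hasDerivWithinAt s (hmom s hs)).fun_add
    (((g.momentumOp (g.π₂ (ξ s₀))).hasFDerivAt.comp_hasDerivWithinAt s
      (hpos s hs)).fun_const_smul (1 / 2 : ℝ))
  rw [map_smul, g.π₁_of_mem (g.momentumOp_mem _ _), hop s hs, momentumOp_leftInvariant,
    ← add_smul, show (1 / 2 : ℝ) + 1 / 2 = 1 by norm_num, one_smul] at h1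
  refine h1.congr (fun t ht => ?_) ?_ <;> rw [horizontalMomentum, hop _ ‹_›]

theorem IsReduced.isBicharacteristic (hc : g.IsReduced J l c h) (hl : l ∈ g.V₂) :
    g.IsBicharacteristic J c (fun s => l + (h s - (1 / 2 : ℝ) • g.momentumOp l (c s))) := by
  set ξ : ℝ → Euc d := fun s => l + (h s - (1 / 2 : ℝ) • g.momentumOp l (c s)) with hξ
  have hmem : ∀ s ∈ J, h s - (1 / 2 : ℝ) • g.momentumOp l (c s) ∈ g.V₁ := fun s hs =>
    g.V₁.sub_mem (hc.mem s hs) (g.V₁.smul_mem _ (g.momentumOp_mem _ _))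
  have hop : ∀ s ∈ J, g.momentumOp (ξ s) = g.momentumOp l := by
    intro s hs
    rw [← momentumOp_π₂, hξ]
    simp only
    rw [map_add, (starProjection_apply_eq_zero_iff _).2
      (le_orthogonal_orthogonal g.V₁ (hmem s hs)), add_zero, momentumOp_π₂]
  have hm : ∀ s ∈ J, g.horizontalMomentum (c s) (ξ s) = h s := by
    intro s hs
    rw [horizontalMomentum, hop s hs, hξ]
    simp only
    rw [map_add, (starProjection_apply_eq_zero_iff _).2 hl, zero_add, g.π₁_of_mem (hmem s hs),
      sub_add_cancel]
  constructor
  · intro s hs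
    rw [(g.hasGradientAt_hamiltonian_momentum (c s) (ξ s)).gradient, hm s hs]
    exact hc.position s hs
  · intro s hs
    rw [(g.hasGradientAt_hamiltonian_position (c s) (ξ s)).gradient, neg_neg, hm s hs, hop s hs]
    have h1 := ((hc.velocity s hs).fun_sub
      (((g.momentumOp l).hasFDerivAt.comp_hasDerivWithinAt s
        (hc.position s hs)).fun_const_smul (1 / 2 : ℝ))).const_add l
    rw [momentumOp_leftInvariant] at h1
    have e : ∀ x : Euc d, (1 / 2 : ℝ) • x = x - (1 / 2 : ℝ) • x := fun x => by module
    rw [e]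
    exact h1

theorem IsReduced.mono {J' : Set ℝ} (hc : g.IsReduced J l c h) (hJ : J' ⊆ J) :
    g.IsReduced J' l c h :=
  ⟨fun s hs => hc.mem s (hJ hs), fun s hs => (hc.position s (hJ hs)).mono hJ,
    fun s hs => (hc.velocity s (hJ hs)).mono hJ⟩

variable (g) in
/-- The restriction of `J_ξ` to the first layer. -/
noncomputable def layerOp (ξ : Euc d) : g.V₁ →L[ℝ] g.V₁ :=
  ((g.momentumOp ξ).comp g.V₁.subtypeL).codRestrict g.V₁ fun x => g.momentumOp_mem ξ x

theorem coe_layerOp (ξ : Euc d) (x : g.V₁) : (g.layerOp ξ x : Euc d) = g.momentumOp ξ x := rfl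

theorem inner_layerOp (ξ : Euc d) (x y : g.V₁) : ⟪g.layerOp ξ x, y⟫ = ⟪ξ, g.bracket x y⟫ :=
  g.inner_momentumOp ξ x y

theorem layerOp_skew (ξ : Euc d) (x y : g.V₁) : ⟪g.layerOp ξ x, y⟫ = -⟪x, g.layerOp ξ y⟫ :=
  g.momentumOp_skew ξ x y

theorem IsReduced.exists_eq_expOp (hc : g.IsReduced J l c h) (hJ : J.OrdConnected) {s₀ : ℝ}
    (hs₀ : s₀ ∈ J) : ∃ v : g.V₁, ∀ s ∈ J, h s = expOp (s • g.layerOp l) v := by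
  have hyh : ∀ s ∈ J, ((g.V₁.orthogonalProjectionOnto (h s) : g.V₁) : Euc d) = h s :=
    fun s hs => g.π₁_of_mem (hc.mem s hs)
  obtain ⟨v, hv⟩ := exists_eq_expOp_of_hasDerivWithinAt (layerOp_skew l) hJ hs₀
    (y := fun s => g.V₁.orthogonalProjectionOnto (h s)) (by
      intro s hs
      have h1 := g.V₁.orthogonalProjectionOnto.hasFDerivAt.comp_hasDerivWithinAt s
        (hc.velocity s hs)
      have h2 : g.V₁.orthogonalProjectionOnto (g.momentumOp l (h s)) =
          g.layerOp l (g.V₁.orthogonalProjectionOnto (h s)) := by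
        apply Subtype.ext
        rw [coe_layerOp, hyh s hs]
        exact g.π₁_of_mem (g.momentumOp_mem l (h s))
      rwa [h2] at h1)
  exact ⟨v, fun s hs => by rw [← hyh s hs, hv s hs]⟩

theorem IsReduced.hasDerivWithinAt_π₁ (hc : g.IsReduced J l c h) {s : ℝ} (hs : s ∈ J) :
    HasDerivWithinAt (fun s => g.π₁ (c s)) (h s) J s := by
  have h1 := g.π₁.hasFDerivAt.comp_hasDerivWithinAt s (hc.position s hs)
  rwa [g.π₁_leftInvariant (hc.mem s hs)] at h1

theorem IsReduced.contDiffOn (hc : g.IsReduced J l c h) (hJ : J.OrdConnected)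
    (hJn : J.Nontrivial) : ContDiffOn ℝ ∞ c J := by
  have hJ' := uniqueDiffOn_interval hJ hJn
  obtain ⟨s₀, hs₀⟩ := hJn.nonempty
  obtain ⟨v, hv⟩ := hc.exists_eq_expOp hJ hs₀
  have hh : ContDiffOn ℝ ∞ h J := by
    refine ContDiffOn.congr ?_ hv
    exact (g.V₁.subtypeL.contDiff.comp (contDiff_expOp _ v)).contDiffOn
  have h1 : ContDiffOn ℝ ∞ (fun s => g.π₁ (c s)) J :=
    contDiffOn_of_hasDerivWithinAt hJ' (fun s hs => hc.hasDerivWithinAt_π₁ hs) hh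
  refine contDiffOn_of_hasDerivWithinAt hJ' hc.position
    (hh.add (ContDiffOn.const_smul (1 / 2 : ℝ) ?_))
  have h2 := (g.bracket.toContinuousBilinearMap).isBoundedBilinearMap.contDiff
    (n := ∞) |>.comp_contDiffOn (h1.prodMk hh)
  refine h2.congr fun s _ => ?_
  exact (g.bracket_π₁_left _ _).symm

end StratifiedLieAlgebra

/-! ### Short arcs of bicharacteristics are minimizing -/

/-- The pointwise inequality behind the minimizing property: `e` is the deviation from the
geodesic, `u - a • k` its velocity, and completing the square in this velocity leaves a nonnegative
multiple of `‖e‖ ^ 2` as long as `‖B‖ * t ≤ 1`. -/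
theorem calibration_deriv_nonneg {E : Type*} [NormedAddCommGroup E] [InnerProductSpace ℝ E]
    {B : E →L[ℝ] E} (hB : ∀ x y, ⟪B x, y⟫ = -⟪x, B y⟫) {a m t : ℝ} (ha : 0 < a) (hm : 0 < m)
    (ht : 0 ≤ t) (htB : ‖B‖ * t ≤ 1) (e u k : E) (hu : m ^ 2 * ‖u‖ ^ 2 ≤ a ^ 2) :
    0 ≤ a / (2 * m ^ 2) - a * ‖k‖ ^ 2 / 2 - ⟪k, u - a • k⟫ - 1 / 2 * ⟪B e, u - a • k⟫
      + 1 / 2 * (‖B‖ ^ 2 / 2) * (a * ‖e‖ ^ 2 + 2 * t * ⟪e, u - a • k⟫) := by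
  set r := u - a • k with hr
  set κ := ‖B‖ ^ 2 / 2 with hκ
  have hur : ‖u‖ ^ 2 = ‖r‖ ^ 2 + 2 * a * ⟪k, r⟫ + a ^ 2 * ‖k‖ ^ 2 := by
    have : u = r + a • k := by rw [hr]; abel
    rw [this, norm_add_sq_real, inner_smul_right, norm_smul, Real.norm_eq_abs, mul_pow, sq_abs,
      real_inner_comm]
    ring
  have hu' : ‖u‖ ^ 2 ≤ a ^ 2 / m ^ 2 := by
    rw [le_div_iff₀ (by positivity)]; linarith
  have hBe : ‖B e‖ ^ 2 ≤ ‖B‖ ^ 2 * ‖e‖ ^ 2 := by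
    rw [← mul_pow]; exact pow_le_pow_left₀ (norm_nonneg _) (B.le_opNorm e) 2
  have heBe : ⟪B e, e⟫ = 0 := by rw [real_inner_comm]; exact inner_apply_self_of_skew hB e
  have hsq : 0 ≤ ‖r + a • ((κ * t) • e - (1 / 2 : ℝ) • B e)‖ ^ 2 := sq_nonneg _
  have hexp : ‖r + a • ((κ * t) • e - (1 / 2 : ℝ) • B e)‖ ^ 2 = ‖r‖ ^ 2
      + 2 * a * (κ * t * ⟪e, r⟫ - 1 / 2 * ⟪B e, r⟫)
      + a ^ 2 * ((κ * t) ^ 2 * ‖e‖ ^ 2 + 1 / 4 * ‖B e‖ ^ 2) := by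
    simp only [← real_inner_self_eq_norm_sq, inner_add_left, inner_add_right, inner_sub_left,
      inner_sub_right, inner_smul_left, inner_smul_right, heBe, real_inner_comm (B e) e,
      real_inner_comm r, RCLike.conj_to_real]
    ring
  rw [hexp] at hsq
  have ht2 : (κ * t) ^ 2 * ‖e‖ ^ 2 ≤ 1 / 4 * ‖B‖ ^ 2 * ‖e‖ ^ 2 := by
    refine mul_le_mul_of_nonneg_right ?_ (sq_nonneg _)
    have h1 : (‖B‖ * t) ^ 2 ≤ 1 := pow_le_one₀ (by positivity) htB
    have h2 : (κ * t) ^ 2 = 1 / 4 * ‖B‖ ^ 2 * (‖B‖ * t) ^ 2 := by rw [hκ]; ring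
    rw [h2]
    exact mul_le_of_le_one_right (by positivity) h1
  have hzero : a ^ 2 * ((κ * t) ^ 2 * ‖e‖ ^ 2 + 1 / 4 * ‖B e‖ ^ 2) ≤ a ^ 2 * (κ * ‖e‖ ^ 2) := by
    refine mul_le_mul_of_nonneg_left ?_ (sq_nonneg _)
    have h1 : κ * ‖e‖ ^ 2 = ‖B‖ ^ 2 * ‖e‖ ^ 2 / 2 := by rw [hκ]; ring
    linarith
  have h2a : 0 ≤ 2 * a * (a / (2 * m ^ 2) - a * ‖k‖ ^ 2 / 2 - ⟪k, r⟫ - 1 / 2 * ⟪B e, r⟫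
      + 1 / 2 * κ * (a * ‖e‖ ^ 2 + 2 * t * ⟪e, r⟫)) := by
    have e1 : 2 * a * (a / (2 * m ^ 2)) = a ^ 2 / m ^ 2 := by field_simp
    linarith
  exact nonneg_of_mul_nonneg_right h2a (by positivity)

namespace StratifiedLieAlgebra

variable {d : ℕ} {g : StratifiedLieAlgebra d} {J : Set ℝ} {c h : ℝ → Euc d} {l : Euc d}

theorem IsReduced.norm_eq (hc : g.IsReduced J l c h) (hJ : J.OrdConnected) {s t : ℝ} (hs : s ∈ J)
    (ht : t ∈ J) : ‖h s‖ = ‖h t‖ :=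
  norm_eq_of_hasDerivWithinAt_skew (g.momentumOp_skew l) hJ hc.velocity hs ht

/-- Comparison of a geodesic arc `c` on `[a, b]` with a horizontal curve `γ` on `[α, β]` with the
same ends and velocity `u`, by means of a time change `σ` whose rate dominates `m` times the
speed of `γ`. The proof integrates `calibration_deriv_nonneg`: the calibrating function takes the
same value at both ends up to the two multiples of `σ`. -/
theorem IsReduced.energy_le {a b α β m : ℝ} (hab : a < b) (hc : g.IsReduced (Icc a b) l c h)
    (hl : l ∈ g.V₂) (hlab : ‖g.momentumOp l‖ * (b - a) ≤ 1) (hm : 0 < m) (hαβ : α < β)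
    {γ u : ℝ → Euc d} (hu : ∀ s ∈ Icc α β, u s ∈ g.V₁)
    (hγ : ∀ s ∈ Icc α β, HasDerivWithinAt γ (g.leftInvariant (u s) (γ s)) (Icc α β) s)
    {σ σ' : ℝ → ℝ} (hσ : ∀ s ∈ Icc α β, HasDerivWithinAt σ (σ' s) (Icc α β) s)
    (hσm : MapsTo σ (Icc α β) (Icc a b)) (hσ' : ∀ s ∈ Icc α β, 0 < σ' s)
    (hσu : ∀ s ∈ Icc α β, m ^ 2 * ‖u s‖ ^ 2 ≤ σ' s ^ 2) (hσα : σ α = a) (hσβ : σ β = b)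
    (hγα : γ α = c a) (hγβ : γ β = c b) : ‖h a‖ ^ 2 ≤ 1 / m ^ 2 := by
  set B := g.momentumOp l with hB
  set V := ‖h a‖ ^ 2 with hV
  set κ := ‖B‖ ^ 2 / 2 with hκ
  set e : ℝ → Euc d := fun s => g.π₁ (γ s) - g.π₁ (c (σ s)) with he
  -- after the two terms in `σ`, the terms come from the vertical momentum, from the boundary terms
  -- of the first variation, and from the Riccati-type function `κ * (σ - a)`
  set F : ℝ → ℝ := fun s => σ s * (1 / (2 * m ^ 2) - V / 2) - ⟪l, γ s - c (σ s)⟫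
    - 1 / 2 * ⟪(2 : ℝ) • h (σ s) - B (c (σ s)), e s⟫
    + 1 / 2 * κ * ((σ s - a) * ⟪e s, e s⟫) with hF
  have hlπ : ∀ x ∈ g.V₁, ⟪l, x⟫ = 0 := fun x hx => by
    rw [real_inner_comm]; exact hl x hx
  have hllI : ∀ v ∈ g.V₁, ∀ x, ⟪l, g.leftInvariant v x⟫ = 1 / 2 * ⟪B x, v⟫ := fun v hv x => by
    rw [leftInvariant, inner_add_right, hlπ v hv, inner_smul_right, zero_add, hB,
      g.inner_momentumOp]
  have hderiv : ∀ s ∈ Icc α β, ∃ D : ℝ, 0 ≤ D ∧ HasDerivWithinAt F D (Icc α β) s := by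
    intro s hs
    have hks : h (σ s) ∈ g.V₁ := hc.mem _ (hσm hs)
    have dc := (hc.position _ (hσm hs)).scomp s (hσ s hs) hσm
    have dk := (hc.velocity _ (hσm hs)).scomp s (hσ s hs) hσm
    have dπc := (hc.hasDerivWithinAt_π₁ (hσm hs)).scomp s (hσ s hs) hσm
    have dπγ : HasDerivWithinAt (fun s => g.π₁ (γ s)) (u s) (Icc α β) s := by
      have := g.π₁.hasFDerivAt.comp_hasDerivWithinAt s (hγ s hs)
      rwa [g.π₁_leftInvariant (hu s hs)] at this
    have de : HasDerivWithinAt e (u s - σ' s • h (σ s)) (Icc α β) s := dπγ.fun_sub dπc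
    have dl : HasDerivWithinAt (fun s => ⟪l, γ s - c (σ s)⟫) _ (Icc α β) s :=
      (innerSL ℝ l).hasFDerivAt.comp_hasDerivWithinAt s ((hγ s hs).fun_sub dc)
    have dB := B.hasFDerivAt.comp_hasDerivWithinAt s dc
    have dkB : HasDerivWithinAt (fun s => (2 : ℝ) • h (σ s) - B (c (σ s))) _ (Icc α β) s :=
      (dk.fun_const_smul (2 : ℝ)).fun_sub dB
    have dF : HasDerivWithinAt F _ (Icc α β) s :=
      ((((hσ s hs).mul_const (1 / (2 * m ^ 2) - V / 2)).fun_sub dl).fun_sub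
        ((dkB.inner ℝ de).const_mul (1 / 2))).fun_add
        ((((hσ s hs).sub_const a).fun_mul (de.inner ℝ de)).const_mul (1 / 2 * κ))
    refine ⟨_, ?_, dF⟩
    have key := calibration_deriv_nonneg (g.momentumOp_skew l) (hσ' s hs) hm
      (t := σ s - a) (by linarith [(hσm hs).1]) (le_trans (mul_le_mul_of_nonneg_left
        (by linarith [(hσm hs).2]) (norm_nonneg _)) hlab) (e s) (u s) (h (σ s)) (hσu s hs)
    rw [hc.norm_eq ordConnected_Icc (hσm hs) (left_mem_Icc.2 hab.le), ← hB, ← hκ, ← hV] at key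
    refine key.trans_eq ?_
    have hBγ : B (γ s) = B (e s) + B (c (σ s)) := by
      rw [he]
      simp only [map_sub]
      rw [hB, momentumOp_π₁, momentumOp_π₁]
      abel
    have hBk : ⟪B (h (σ s)), e s⟫ = -⟪h (σ s), B (e s)⟫ := g.momentumOp_skew l _ _
    have hk2 : ⟪h (σ s), h (σ s)⟫ = V := by
      rw [real_inner_self_eq_norm_sq, hc.norm_eq ordConnected_Icc (hσm hs)
        (left_mem_Icc.2 hab.le)]
    simp only [innerSL_apply_apply, map_smul, inner_sub_left,
      inner_sub_right, inner_smul_left, inner_smul_right, hllI _ (hu s hs), hllI _ hks,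
      RCLike.conj_to_real]
    rw [hB, momentumOp_leftInvariant, ← hB, hBγ, ← real_inner_self_eq_norm_sq (e s)]
    simp only [inner_add_left, hBk, hk2]
    rw [real_inner_comm (e s) (h (σ s)), real_inner_comm (e s) (u s),
      real_inner_comm (B (e s)) (h (σ s))]
    ring
  have hmono : MonotoneOn F (Icc α β) := by
    choose! D hD0 hD using hderiv
    refine monotoneOn_of_deriv_nonneg (convex_Icc α β)
      (fun s hs => (hD s hs).continuousWithinAt) ?_ ?_
    · intro s hs
      exact ((hD s (interior_subset hs)).mono interior_subset).differentiableWithinAt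
    · intro s hs
      rw [((hD s (interior_subset hs)).hasDerivAt (mem_interior_iff_mem_nhds.1 hs)).deriv]
      exact hD0 s (interior_subset hs)
  have hends := hmono (left_mem_Icc.2 hαβ.le) (right_mem_Icc.2 hαβ.le) hαβ.le
  simp only [hF, he, hσα, hσβ, hγα, hγβ, sub_self, inner_zero_right, sub_zero] at hends
  have h1 : 0 ≤ 1 / (2 * m ^ 2) - V / 2 :=
    nonneg_of_mul_nonneg_right (by linarith : 0 ≤ (b - a) * (1 / (2 * m ^ 2) - V / 2))
      (by linarith)
  have h2 : 1 / (2 * m ^ 2) = 1 / m ^ 2 / 2 := by field_simp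
  linarith

theorem IsReduced.length_le {a b α β : ℝ} (hab : a < b) (hc : g.IsReduced (Icc a b) l c h)
    (hl : l ∈ g.V₂) (hlab : ‖g.momentumOp l‖ * (b - a) ≤ 1) (hαβ : α < β)
    {γ : ℝ → Euc d} (hγ : g.IsHorizontal γ α β) (hγα : γ α = c a) (hγβ : γ β = c b) :
    (b - a) * ‖h a‖ ≤ g.length γ α β := by
  have hU : UniqueDiffOn ℝ (Icc α β) := uniqueDiffOn_Icc hαβ
  set u : ℝ → Euc d := fun s => g.π₁ (derivWithin γ (Icc α β) s) with hu
  have huV : ∀ s, u s ∈ g.V₁ := fun s => starProjection_apply_mem _ _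
  have hγd : ∀ s ∈ Icc α β,
      HasDerivWithinAt γ (g.leftInvariant (u s) (γ s)) (Icc α β) s := by
    intro s hs
    obtain ⟨v, hv, e⟩ := hγ.tangent s hs
    have h1 := (hγ.smooth.differentiableOn (by simp) s hs).hasDerivWithinAt
    have h2 : u s = v := by rw [hu]; simp only; rw [e, g.π₁_leftInvariant hv]
    rwa [h2, ← e]
  have hucont : ContinuousOn u (Icc α β) :=
    g.π₁.continuous.comp_continuousOn (hγ.smooth.continuousOn_derivWithin hU (by simp))
  -- `δ` bounds the total cost of regularizing the speed by `ε`
  refine le_of_forall_pos_le_add fun δ hδ => ?_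
  set ε : ℝ := δ / (β - α) with hε
  have hβα : 0 < β - α := sub_pos.2 hαβ
  have hε0 : 0 < ε := div_pos hδ hβα
  -- regularized speed, positive also where the velocity vanishes
  set ρ : ℝ → ℝ := fun s => √(‖u s‖ ^ 2 + ε ^ 2) with hρ
  have hρcont : ContinuousOn ρ (Icc α β) := ((hucont.norm.pow 2).add continuousOn_const).sqrt
  set ρ' : ℝ → ℝ := IccExtend hαβ.le ((Icc α β).domRestrict ρ) with hρ'
  have hρ'cont : Continuous ρ' := hρcont.domRestrict.Icc_extend'
  have hρρ' : ∀ s ∈ Icc α β, ρ' s = ρ s := fun s hs => IccExtend_of_mem hαβ.le _ hs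
  have hρ'pos : ∀ s, 0 < ρ' s := fun s => Real.sqrt_pos.2 (by positivity)
  set L : ℝ := ∫ s in α..β, ρ' s with hL
  have hL0 : 0 < L := intervalIntegral.intervalIntegral_pos_of_pos
    (hρ'cont.intervalIntegrable _ _) hρ'pos hαβ
  set m : ℝ := (b - a) / L with hm
  have hm0 : 0 < m := div_pos (sub_pos.2 hab) hL0
  set σ : ℝ → ℝ := fun s => a + m * ∫ t in α..s, ρ' t with hσ
  have hσd : ∀ s, HasDerivAt σ (m * ρ' s) s := fun s =>
    ((intervalIntegral.integral_hasDerivAt_right (hρ'cont.intervalIntegrable _ _)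
      hρ'cont.aestronglyMeasurable.stronglyMeasurableAtFilter
      hρ'cont.continuousAt).const_mul m).const_add a
  have hσα : σ α = a := by simp [hσ]
  have hσβ : σ β = b := by
    rw [hσ]; simp only; rw [← hL, hm, div_mul_cancel₀ _ hL0.ne']; ring
  have hσmono : Monotone σ := monotone_of_deriv_nonneg (fun s => (hσd s).differentiableAt)
    fun s => by rw [(hσd s).deriv]; exact (mul_pos hm0 (hρ'pos s)).le
  have hσm : MapsTo σ (Icc α β) (Icc a b) := fun s hs =>
    ⟨hσα ▸ hσmono hs.1, hσβ ▸ hσmono hs.2⟩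
  have key := hc.energy_le hab hl hlab hm0 hαβ (fun s _ => huV s) hγd
    (fun s _ => (hσd s).hasDerivWithinAt) hσm (fun s _ => mul_pos hm0 (hρ'pos s))
    (fun s hs => by
      rw [mul_pow, hρρ' s hs, hρ]
      simp only
      rw [Real.sq_sqrt (by positivity)]
      exact mul_le_mul_of_nonneg_left (by linarith [sq_nonneg ε]) (sq_nonneg m))
    hσα hσβ hγα hγβ
  have h1 : (b - a) * ‖h a‖ ≤ L := by
    refine abs_le_of_sq_le_sq' ?_ hL0.le |>.2
    rw [hm, div_pow, one_div_div, le_div_iff₀ (by nlinarith)] at key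
    linarith
  have h2 : L ≤ ∫ s in α..β, (‖u s‖ + ε) := by
    refine intervalIntegral.integral_mono_on hαβ.le (hρ'cont.intervalIntegrable _ _) ?_ ?_
    · exact (ContinuousOn.intervalIntegrable_of_Icc hαβ.le
        (hucont.norm.add continuousOn_const))
    · intro s hs
      rw [hρρ' s hs]
      refine Real.sqrt_le_iff.2 ⟨by positivity, ?_⟩
      nlinarith [norm_nonneg (u s)]
  rw [intervalIntegral.integral_add
    (ContinuousOn.intervalIntegrable_of_Icc hαβ.le hucont.norm) (by simp),
    intervalIntegral.integral_const, smul_eq_mul, hε, mul_div_cancel₀ _ hβα.ne'] at h2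
  exact h1.trans h2

theorem IsReduced.isMinimizer {a b : ℝ} (hab : a < b) (hc : g.IsReduced (Icc a b) l c h)
    (hl : l ∈ g.V₂) (hlab : ‖g.momentumOp l‖ * (b - a) ≤ 1) : g.IsMinimizer c a b := by
  have hd : ∀ s ∈ Icc a b, derivWithin c (Icc a b) s = g.leftInvariant (h s) (c s) := fun s hs =>
    (hc.position s hs).derivWithin (uniqueDiffOn_Icc hab s hs)
  have hhor : g.IsHorizontal c a b :=
    ⟨hc.contDiffOn ordConnected_Icc (nontrivial_of_exists_lt
      ⟨a, left_mem_Icc.2 hab.le, b, right_mem_Icc.2 hab.le, hab⟩),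
      fun s hs => ⟨h s, hc.mem s hs, hd s hs⟩⟩
  have hlen : g.length c a b = (b - a) * ‖h a‖ := by
    rw [length, intervalIntegral.integral_congr (g := fun _ => ‖h a‖),
      intervalIntegral.integral_const, smul_eq_mul]
    intro s hs
    rw [uIcc_of_le hab.le] at hs
    simp only
    rw [hd s hs, g.π₁_leftInvariant (hc.mem s hs),
      hc.norm_eq ordConnected_Icc hs (left_mem_Icc.2 hab.le)]
  refine ⟨hhor, le_antisymm ?_ ?_⟩
  · refine le_iInf fun γ => le_iInf fun α => le_iInf fun β => le_iInf fun hαβ => le_iInf fun hγ =>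
      le_iInf fun hγα => le_iInf fun hγβ => ?_
    rw [hlen]
    exact ENNReal.ofReal_le_ofReal (hc.length_le hab hl hlab hαβ hγ hγα hγβ)
  · exact iInf_le_of_le c <| iInf_le_of_le a <| iInf_le_of_le b <| iInf_le_of_le hab <|
      iInf_le_of_le hhor <| iInf_le_of_le rfl <| iInf_le_of_le rfl le_rfl

theorem IsReduced.isNormalGeodesic (hc : g.IsReduced J l c h) (hJ : J.OrdConnected)
    (hl : l ∈ g.V₂) : g.IsNormalGeodesic J c where
  normal := ⟨_, hc.isBicharacteristic hl⟩
  minimizing := by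
    intro s _
    set N := ‖g.momentumOp l‖ with hN
    have hN0 : 0 ≤ N := norm_nonneg _
    refine ⟨1 / (2 * (N + 1)), by positivity, fun a ha b hb hab has hbs => ?_⟩
    refine (hc.mono (hJ.out ha hb)).isMinimizer hab hl ?_
    have h1 : b - a ≤ 1 / (N + 1) := by
      have e : 1 / (N + 1) = 1 / (2 * (N + 1)) + 1 / (2 * (N + 1)) := by field_simp; norm_num
      linarith [(abs_lt.1 has).1, (abs_lt.1 hbs).2]
    calc N * (b - a) ≤ N * (1 / (N + 1)) := mul_le_mul_of_nonneg_left h1 hN0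
      _ ≤ 1 := by rw [mul_one_div, div_le_one (by positivity)]; linarith

end StratifiedLieAlgebra

/-! ### Dual bases of subspaces -/

section DualBasis

variable {E ι : Type*} [NormedAddCommGroup E] [InnerProductSpace ℝ E] [Fintype ι] [DecidableEq ι]
  {K : Submodule ℝ E} {l w : ι → E}

theorem eq_sum_inner_smul_of_dual (hw : ∀ α, w α ∈ K) (hl : span ℝ (range l) = K)
    (hd : ∀ α β, ⟪l α, w β⟫ = if α = β then 1 else 0) {y : E} (hy : y ∈ K) :
    y = ∑ α, ⟪l α, y⟫ • w α := by
  have hz : y - ∑ α, ⟪l α, y⟫ • w α ∈ K :=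
    K.sub_mem hy (K.sum_mem fun α _ => K.smul_mem _ (hw α))
  have h : ∀ x ∈ K, ⟪x, y - ∑ α, ⟪l α, y⟫ • w α⟫ = 0 := by
    intro x hx
    rw [← hl] at hx
    induction hx using Submodule.span_induction with
    | mem x hx =>
      obtain ⟨β, rfl⟩ := hx
      simp [inner_sub_right, inner_sum, inner_smul_right, hd]
    | zero => simp
    | add x x' _ _ h h' => rw [inner_add_left, h, h', add_zero]
    | smul a x _ h => rw [inner_smul_left, h, mul_zero]
  exact sub_eq_zero.1 (inner_self_eq_zero.1 (h _ hz))

theorem exists_dual_family (hli : LinearIndependent ℝ w) (hw : span ℝ (range w) = K) :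
    ∃ l : ι → E, LinearIndependent ℝ l ∧ span ℝ (range l) = K ∧
      ∀ α β, ⟪l α, w β⟫ = if α = β then 1 else 0 := by
  subst hw
  let b := Module.Basis.span hli
  have hb : ∀ α, (b α : E) = w α := fun α =>
    congrArg Subtype.val (Module.Basis.span_apply hli α)
  have hnd : (innerₗ (span ℝ (range w))).Nondegenerate :=
    ⟨fun x hx => inner_self_eq_zero.1 (hx x), fun x hx => inner_self_eq_zero.1 (hx x)⟩
  let b' := LinearMap.BilinForm.dualBasis (innerₗ (span ℝ (range w))) hnd b
  refine ⟨fun α => (b' α : E), ?_, ?_, fun α β => ?_⟩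
  · exact b'.linearIndependent.map' (span ℝ (range w)).subtype (ker_subtype _)
  · have h := congrArg (Submodule.map (span ℝ (range w)).subtype) b'.span_eq
    rw [Submodule.map_span, ← range_comp, Submodule.map_top, range_subtype] at h
    exact h
  · have h := LinearMap.BilinForm.apply_dualBasis_left hnd b α β
    rw [← hb β]
    simp only [@eq_comm _ α β]
    exact h

end DualBasis

/-! ### Brackets assembled from skew-symmetric operators -/

section Assembly

variable {d p : ℕ} {H : Submodule ℝ (Euc d)} {A : Fin p → H →L[ℝ] H} {w : Fin p → Euc d}

/-- The bracket `[x, y] = ∑ ⟪A_α x, y⟫ w_α` on `H`, extended by zero to the orthogonal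
complement. -/
noncomputable def operatorBracket (A : Fin p → H →L[ℝ] H) (w : Fin p → Euc d) :
    Euc d →ₗ[ℝ] Euc d →ₗ[ℝ] Euc d :=
  ∑ α, ((innerₗ H).compl₁₂ ((A α : H →ₗ[ℝ] H) ∘ₗ H.orthogonalProjectionOnto.toLinearMap)
    H.orthogonalProjectionOnto.toLinearMap).compr₂ (LinearMap.toSpanSingleton ℝ (Euc d) (w α))

theorem operatorBracket_apply (x y : Euc d) : operatorBracket A w x y =
    ∑ α, ⟪A α (H.orthogonalProjectionOnto x), H.orthogonalProjectionOnto y⟫ • w α := by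
  simp only [operatorBracket, LinearMap.sum_apply]
  rfl

theorem operatorBracket_coe (x y : H) :
    operatorBracket A w x y = ∑ α, ⟪A α x, y⟫ • w α := by
  rw [operatorBracket_apply, orthogonalProjectionOnto_mem_subspace_eq_self,
    orthogonalProjectionOnto_mem_subspace_eq_self]

theorem inner_operatorBracket (φ : Euc d) (x y : H) :
    ⟪φ, operatorBracket A w x y⟫ = ⟪(∑ α, ⟪φ, w α⟫ • A α) x, y⟫ := by
  rw [operatorBracket_coe, inner_sum, sum_apply, sum_inner]
  refine Finset.sum_congr rfl fun α _ => ?_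
  rw [inner_smul_right, smul_apply, inner_smul_left, RCLike.conj_to_real, mul_comm]

/-- Linear independence of the operators amounts to `[H, H] = Hᗮ`. -/
theorem linearIndependent_iff_span_operatorBracket (hli : LinearIndependent ℝ w)
    (hw : span ℝ (range w) = Hᗮ) : LinearIndependent ℝ A ↔
      span ℝ {z | ∃ x ∈ H, ∃ y ∈ H, z = operatorBracket A w x y} = Hᗮ := by
  have hwm : ∀ α, w α ∈ Hᗮ := fun α => hw ▸ subset_span (mem_range_self α)
  have hle : span ℝ {z | ∃ x ∈ H, ∃ y ∈ H, z = operatorBracket A w x y} ≤ Hᗮ := by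
    refine span_le.2 ?_
    rintro z ⟨x, _, y, _, rfl⟩
    rw [operatorBracket_apply]
    exact Submodule.sum_mem _ fun α _ => Submodule.smul_mem _ _ (hwm α)
  have hzero : ∀ {φ : Euc d}, φ ∈ Hᗮ → (∀ α, ⟪φ, w α⟫ = 0) → φ = 0 := by
    intro φ hφ h
    obtain ⟨l, -, hl, hd⟩ := exists_dual_family hli hw
    have hd' : ∀ α β, ⟪w α, l β⟫ = if α = β then 1 else 0 := fun α β => by
      rw [real_inner_comm, hd]; simp only [eq_comm]
    rw [eq_sum_inner_smul_of_dual (fun α => hl ▸ subset_span (mem_range_self α)) hw hd' hφ]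
    exact Finset.sum_eq_zero fun α _ => by rw [real_inner_comm, h, zero_smul]
  constructor
  · intro hA
    refine le_antisymm hle fun z hz => ?_
    set S := span ℝ {z | ∃ x ∈ H, ∃ y ∈ H, z = operatorBracket A w x y} with hS
    -- a covector on `Hᗮ` which kills all brackets is a relation between the operators
    have hr : z - S.starProjection z ∈ Sᗮ := sub_starProjection_mem_orthogonal z
    have hsum : ∑ α, ⟪z - S.starProjection z, w α⟫ • A α = 0 := by
      ext x : 1
      refine ext_inner_right ℝ fun y => ?_
      rw [← inner_operatorBracket, real_inner_comm,
        hr _ (subset_span ⟨x, x.2, y, y.2, rfl⟩), zero_apply, inner_zero_left]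
    have h0 := hzero (Hᗮ.sub_mem hz (hle (starProjection_apply_mem _ _)))
      (Fintype.linearIndependent_iff.1 hA _ hsum)
    rw [sub_eq_zero.1 h0]
    exact starProjection_apply_mem _ _
  · intro hspan
    refine Fintype.linearIndependent_iff.2 fun a ha α => ?_
    obtain ⟨l, -, hl, hd⟩ := exists_dual_family hli hw
    have hlm : ∀ α, l α ∈ Hᗮ := fun α => hl ▸ subset_span (mem_range_self α)
    set φ : Euc d := ∑ α, a α • l α with hφ
    have hφw : ∀ β, ⟪φ, w β⟫ = a β := fun β => by
      simp [hφ, sum_inner, inner_smul_left, hd]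
    have hφ0 : φ = 0 := by
      have h : ∀ z ∈ Hᗮ, ⟪φ, z⟫ = 0 := by
        intro z hz
        rw [← hspan] at hz
        induction hz using Submodule.span_induction with
        | mem z hz =>
          obtain ⟨x, hx, y, hy, rfl⟩ := hz
          have := inner_operatorBracket (A := A) (w := w) φ ⟨x, hx⟩ ⟨y, hy⟩
          simp only [hφw, ha] at this
          simpa using this
        | zero => simp
        | add x x' _ _ h h' => rw [inner_add_right, h, h', add_zero]
        | smul a x _ h => rw [inner_smul_right, h, mul_zero]
      exact inner_self_eq_zero.1 (h φ (Submodule.sum_mem _ fun α _ =>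
        Submodule.smul_mem _ _ (hlm α)))
    rw [← hφw α, hφ0, inner_zero_left]

/-- The stratified Lie algebra with bracket `[x, y] = ∑ ⟪A_α x, y⟫ w_α`. -/
noncomputable def operatorLieAlgebra (hp : 0 < p)
    (hskew : ∀ α, ∀ x y : H, ⟪A α x, y⟫ = -⟪x, A α y⟫) (hli : LinearIndependent ℝ w)
    (hw : span ℝ (range w) = Hᗮ) (hA : LinearIndependent ℝ A) : StratifiedLieAlgebra d where
  V₁ := H
  bracket := operatorBracket A w
  bracket_self x := by
    rw [operatorBracket_apply]
    refine Finset.sum_eq_zero fun α _ => ?_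
    rw [real_inner_comm, inner_apply_self_of_skew (hskew α), zero_smul]
  jacobi x y z := by
    have h0 : ∀ x y z, operatorBracket A w x (operatorBracket A w y z) = 0 := by
      intro x y z
      have hm : operatorBracket A w y z ∈ Hᗮ := by
        rw [operatorBracket_apply]
        exact Submodule.sum_mem _ fun α _ => Submodule.smul_mem _ _
          (hw ▸ subset_span (mem_range_self α))
      rw [operatorBracket_apply,
        orthogonalProjectionOnto_apply_of_mem_orthogonal hm]
      simp
    rw [h0, h0, h0, add_zero, add_zero]
  generates := (linearIndependent_iff_span_operatorBracket hli hw).1 hA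
  central x t ht := by
    rw [operatorBracket_apply,
      orthogonalProjectionOnto_apply_of_mem_orthogonal ht]
    simp
  step_two h := hli.ne_zero ⟨0, hp⟩ (by
    have : w ⟨0, hp⟩ ∈ Hᗮ := hw ▸ subset_span (mem_range_self _)
    rwa [h, mem_bot] at this)

end Assembly

namespace StratifiedLieAlgebra

variable {d : ℕ} {g : StratifiedLieAlgebra d} {J : Set ℝ} {c c' h : ℝ → Euc d} {l : Euc d}

/-! ### Geodesics and curves with prescribed horizontal projection -/

/-- The horizontal velocity and the starting point can be prescribed; the position is found by
integrating the horizontal component first. -/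
theorem exists_isReduced (g : StratifiedLieAlgebra d) (l : Euc d) (v : g.V₁) (x : Euc d)
    (s₀ : ℝ) : ∃ c, c s₀ = x ∧
      g.IsReduced univ l c (fun s => (expOp (s • g.layerOp l) v : g.V₁)) := by
  set h : ℝ → Euc d := fun s => (expOp (s • g.layerOp l) v : g.V₁) with hh
  have hhd : ∀ s, HasDerivAt h (g.momentumOp l (h s)) s := fun s =>
    g.V₁.subtypeL.hasFDerivAt.comp_hasDerivAt s (hasDerivAt_expOp (g.layerOp l) v s)
  have hhc : Continuous h := continuous_iff_continuousAt.2 fun s => (hhd s).continuousAt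
  have hhm : ∀ s, h s ∈ g.V₁ := fun s => SetLike.coe_mem _
  have hint : ∀ {f : ℝ → Euc d}, Continuous f → ∀ s,
      HasDerivAt (fun s => ∫ t in s₀..s, f t) (f s) s := fun hf s =>
    intervalIntegral.integral_hasDerivAt_right (hf.intervalIntegrable _ _)
      hf.aestronglyMeasurable.stronglyMeasurableAtFilter hf.continuousAt
  set c₁ : ℝ → Euc d := fun s => g.π₁ (x + ∫ t in s₀..s, h t) with hc₁
  have hd₁ : ∀ s, HasDerivAt c₁ (h s) s := by
    intro s
    have := g.π₁.hasFDerivAt.comp_hasDerivAt s ((hint hhc s).const_add x)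
    rwa [g.π₁_of_mem (hhm s)] at this
  have hcc : Continuous c₁ := continuous_iff_continuousAt.2 fun s => (hd₁ s).continuousAt
  set f : ℝ → Euc d := fun s => (1 / 2 : ℝ) • g.bracket (c₁ s) (h s) with hf
  have hfc : Continuous f := by
    have : Continuous fun s => g.bracket.toContinuousBilinearMap (c₁ s) (h s) := by fun_prop
    exact this.const_smul (1 / 2 : ℝ)
  set c₂ : ℝ → Euc d := fun s => g.π₂ (x + ∫ t in s₀..s, f t) with hc₂
  have hd₂ : ∀ s, HasDerivAt c₂ (f s) s := by
    intro s
    have := g.π₂.hasFDerivAt.comp_hasDerivAt s ((hint hfc s).const_add x)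
    rwa [starProjection_eq_self_iff.2 (g.V₂.smul_mem _ (g.bracket_mem _ _))] at this
  refine ⟨fun s => c₁ s + c₂ s, ?_, ⟨fun s _ => hhm s, fun s _ => ?_, fun s _ =>
    (hhd s).hasDerivWithinAt⟩⟩
  · simp only [hc₁, hc₂, intervalIntegral.integral_same, add_zero]
    exact g.π₁_add_π₂ x
  · have hπ : g.π₁ (c₁ s + c₂ s) = c₁ s := by
      rw [map_add, g.π₁_of_mem (starProjection_apply_mem _ _),
        (starProjection_apply_eq_zero_iff _).2 (starProjection_apply_mem _ _), add_zero]
    rw [leftInvariant, ← bracket_π₁_left, hπ]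
    exact ((hd₁ s).fun_add (hd₂ s)).hasDerivWithinAt

/-- A normal geodesic is determined by its horizontal projection and its starting point. -/
theorem IsNormalGeodesic.eqOn (hJ : J.OrdConnected) (hJn : J.Nontrivial) {s₀ : ℝ} (hs₀ : s₀ ∈ J)
    (hc : g.IsNormalGeodesic J c) (hc' : g.IsNormalGeodesic J c')
    (hπ : ∀ s ∈ J, g.π₁ (c s) = g.π₁ (c' s)) (h₀ : c s₀ = c' s₀) : EqOn c c' J := by
  obtain ⟨ξ, hξ⟩ := hc.normal
  obtain ⟨ξ', hξ'⟩ := hc'.normal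
  have h := hξ.isReduced hJ hs₀
  have h' := hξ'.isReduced hJ hs₀
  refine eqOn_of_hasDerivWithinAt hJ h.position (fun s hs => ?_) hs₀ h₀
  have e := (uniqueDiffOn_interval hJ hJn s hs).eq_deriv _ (h.hasDerivWithinAt_π₁ hs)
    ((h'.hasDerivWithinAt_π₁ hs).congr hπ (hπ s hs))
  have h1 := h'.position s hs
  rw [leftInvariant, ← bracket_π₁_left, ← hπ s hs, ← e, bracket_π₁_left, ← leftInvariant] at h1
  exact h1

theorem π₂_add_horizontal (hl : l ∈ g.V₂) {x : Euc d} (hx : x ∈ g.V₁) : g.π₂ (l + x) = l := by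
  rw [map_add, starProjection_eq_self_iff.2 hl,
    (starProjection_apply_eq_zero_iff _).2 (le_orthogonal_orthogonal g.V₁ hx), add_zero]

end StratifiedLieAlgebra

/-! ### The correspondence -/

section Correspondence

variable {d p : ℕ} {J : Fin p → Set ℝ} {s₀ : Fin p → ℝ} {H : Submodule ℝ (Euc d)}
  {μ c : Fin p → ℝ → Euc d} {A : Fin p → H →L[ℝ] H}

theorem IsHelicalForm.verticalDirection_eq {J : Set ℝ} {s₀ : ℝ} (hs₀ : s₀ ∈ J) {μ : ℝ → Euc d}
    {A : H →L[ℝ] H} {v : H} {w : Hᗮ} (h : IsHelicalForm J μ H A v w)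
    (hH : horizontalSpace J μ = H) : verticalDirection J s₀ μ = w := by
  subst hH
  exact h.starProjection_derivWithin hs₀

/-- A Lie algebra that corresponds to a curve tuple has the bracket assembled from the canonical
operators and the vertical directions of the curves. -/
theorem IsCurveTuple.bracket_eq_of_corresponds (hJ : ∀ α, UniqueDiffOn ℝ (J α))
    (hs₀ : ∀ α, s₀ α ∈ J α) (hμ : IsCurveTuple J s₀ H μ)
    (hA : ∀ α, ∃ v w, IsHelicalForm (J α) (μ α) H (A α) v w) {g : StratifiedLieAlgebra d}
    (hg : g.V₁ = H) (hc : g.Corresponds J s₀ μ c) : g.bracket =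
      operatorBracket A (fun α => verticalDirection (J α) (s₀ α) (μ α)) := by
  subst hg
  obtain ⟨A', v, w, hA', hbr⟩ := hc.structure_eq
  have hAA : A' = A := funext fun α => by
    obtain ⟨v', w', h⟩ := hA α
    exact (hA' α).operator_unique (hJ α) (hμ.horizontal α) h
  subst hAA
  refine LinearMap.ext fun x => LinearMap.ext fun y => ?_
  rw [operatorBracket_apply, ← g.bracket_π₁_left, ← g.bracket_π₁_right]
  refine (hbr (g.V₁.orthogonalProjectionOnto x) (g.V₁.orthogonalProjectionOnto y)).trans ?_
  exact Finset.sum_congr rfl fun α _ => by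
    rw [(hA' α).verticalDirection_eq (hs₀ α) (hμ.horizontal α)]

/-- Linearly independent operators of a curve tuple produce a corresponding Lie algebra and
geodesics: the vertical momenta are dual to the vertical directions, so that `J_{l_α} = A_α`. -/
theorem IsCurveTuple.exists_corresponds (hp : 0 < p)
    (hJ : ∀ α, (J α).OrdConnected ∧ (J α).Nontrivial) (hs₀ : ∀ α, s₀ α ∈ J α)
    (hμ : IsCurveTuple J s₀ H μ) (hA : ∀ α, ∃ v w, IsHelicalForm (J α) (μ α) H (A α) v w)
    (hli : LinearIndependent ℝ A) : ∃ (g : StratifiedLieAlgebra d) (c : Fin p → ℝ → Euc d),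
      g.V₁ = H ∧ g.IsDistinguished J s₀ c ∧ g.Corresponds J s₀ μ c := by
  have hJ' : ∀ α, UniqueDiffOn ℝ (J α) := fun α => uniqueDiffOn_interval (hJ α).1 (hJ α).2
  choose v w hvw using hA
  have hwv : ∀ α, verticalDirection (J α) (s₀ α) (μ α) = w α := fun α =>
    (hvw α).verticalDirection_eq (hs₀ α) (hμ.horizontal α)
  have hwli : LinearIndependent ℝ (fun α => (w α : Euc d)) := by
    simpa only [hwv] using hμ.vertical_linearIndependent
  have hwsp : span ℝ (range fun α => (w α : Euc d)) = Hᗮ := by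
    simpa only [hwv] using hμ.vertical_span
  obtain ⟨g, rfl, hbr⟩ : ∃ g : StratifiedLieAlgebra d, g.V₁ = H ∧
      g.bracket = operatorBracket A (fun α => (w α : Euc d)) :=
    ⟨operatorLieAlgebra hp (fun α => (hvw α).skew) hwli hwsp hli, rfl, rfl⟩
  obtain ⟨l, hlli, hlsp, hd⟩ := exists_dual_family hwli hwsp
  have hl : ∀ α, l α ∈ g.V₂ := fun α => hlsp.le (subset_span (mem_range_self α))
  have hop : ∀ α, g.layerOp (l α) = A α := by
    intro α
    ext x : 1
    refine ext_inner_right ℝ fun y => ?_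
    rw [StratifiedLieAlgebra.inner_layerOp, hbr, inner_operatorBracket]
    have e : ∑ β, ⟪l α, w β⟫ • A β = A α := by
      rw [Finset.sum_eq_single α (fun β _ hβ => ?_) (by simp), hd, if_pos rfl]
      · exact one_smul ℝ (A α)
      · rw [hd, if_neg hβ.symm]
        exact zero_smul ℝ (A β)
    rw [e]
  choose c hc₀ hc using fun α => g.exists_isReduced (l α) (v α) (μ α (s₀ α)) (s₀ α)
  simp only [hop] at hc
  have hcJ := fun α => (hc α).mono (subset_univ (J α))
  have hdμ : ∀ α, ∀ s ∈ J α, HasDerivWithinAt (fun s => g.π₁ (μ α s))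
      ((expOp (s • A α) (v α) : g.V₁) : Euc d) (J α) s := by
    intro α s hs
    have h1 := ((hμ.isQ α).smooth.differentiableOn (by simp) s hs).hasDerivWithinAt
    rw [(hvw α).velocity s hs] at h1
    have h2 := g.π₁.hasFDerivAt.comp_hasDerivWithinAt s h1
    rwa [map_add, g.π₁_of_mem (SetLike.coe_mem _),
      (starProjection_apply_eq_zero_iff _).2 (w α).2, add_zero] at h2
  have hproj : ∀ α, EqOn (fun s => g.π₁ (μ α s)) (fun s => g.π₁ (c α s)) (J α) := fun α =>
    eqOn_of_hasDerivWithinAt (hJ α).1 (hdμ α) (fun s hs => (hcJ α).hasDerivWithinAt_π₁ hs)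
      (hs₀ α) (congrArg g.π₁ (hc₀ α).symm)
  refine ⟨g, c, rfl, ⟨fun α => (hcJ α).isNormalGeodesic (hJ α).1 (hl α),
    ⟨_, fun α => (hcJ α).isBicharacteristic (hl α), ?_⟩, fun α => ?_⟩, hproj,
    fun α => (hc₀ α).symm, A, v, w, hvw, fun x y => ?_⟩
  · have : ∀ α, g.π₂ (l α + (((expOp (s₀ α • A α) (v α) : g.V₁) : Euc d)
        - (1 / 2 : ℝ) • g.momentumOp (l α) (c α (s₀ α)))) = l α := fun α =>
      StratifiedLieAlgebra.π₂_add_horizontal (hl α)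
        (g.V₁.sub_mem (SetLike.coe_mem _) (g.V₁.smul_mem _ (g.momentumOp_mem _ _)))
    beta_reduce
    simp only [this]
    exact ⟨hlli, hlsp⟩
  · rw [← hμ.horizontal α]
    refine (horizontalSpace_congr (w := (w α : Euc d)) fun s hs => ?_).symm
    rw [((hcJ α).hasDerivWithinAt_π₁ hs).derivWithin (hJ' α s hs), (hvw α).velocity s hs,
      add_comm]
  · rw [hbr, operatorBracket_coe]

/-- Geodesics with a momentum basis produce corresponding curves: their vertical directions form
the basis dual to the vertical momenta. -/
theorem StratifiedLieAlgebra.HasMomentumBasis.exists_corresponds {g : StratifiedLieAlgebra d}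
    (hJ : ∀ α, (J α).OrdConnected ∧ (J α).Nontrivial) (hs₀ : ∀ α, s₀ α ∈ J α)
    (hc : g.HasMomentumBasis J s₀ c) :
    ∃ (μ : Fin p → ℝ → Euc d) (A : Fin p → g.V₁ →L[ℝ] g.V₁) (v : Fin p → g.V₁)
      (w : Fin p → g.V₁ᗮ), (∀ α, IsQ 1 (J α) (μ α)) ∧ g.Corresponds J s₀ μ c ∧
      (∀ α, IsHelicalForm (J α) (μ α) g.V₁ (A α) (v α) (w α)) ∧
      LinearIndependent ℝ (fun α => (w α : Euc d)) ∧
      span ℝ (range fun α => (w α : Euc d)) = g.V₁ᗮ ∧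
      ∀ α, horizontalSpace (J α) (μ α) = horizontalSpace (J α) (fun s => g.π₁ (c α s)) := by
  have hJ' : ∀ α, UniqueDiffOn ℝ (J α) := fun α => uniqueDiffOn_interval (hJ α).1 (hJ α).2
  obtain ⟨ξ, hξ, hlli, hlsp⟩ := hc
  set l : Fin p → Euc d := fun α => g.π₂ (ξ α (s₀ α)) with hl
  obtain ⟨w, hwli, hwsp, hd⟩ := exists_dual_family hlli hlsp
  have hwm : ∀ α, w α ∈ g.V₂ := fun α => hwsp.le (subset_span (mem_range_self α))
  have hd' : ∀ α β, ⟪l α, w β⟫ = if α = β then 1 else 0 := fun α β => by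
    rw [real_inner_comm, hd]; simp only [eq_comm]
  have hred := fun α => (hξ α).isReduced (hJ α).1 (hs₀ α)
  choose v hv using fun α => (hred α).exists_eq_expOp (hJ α).1 (hs₀ α)
  set μ : Fin p → ℝ → Euc d := fun α s =>
    g.π₁ (c α s) + (g.π₂ (c α (s₀ α)) + (s - s₀ α) • w α) with hμ
  have hμd : ∀ α, ∀ s ∈ J α, HasDerivWithinAt (μ α)
      (((expOp (s • g.layerOp (l α)) (v α) : g.V₁) : Euc d) + w α) (J α) s := by
    intro α s hs
    have h1 := (hred α).hasDerivWithinAt_π₁ hs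
    rw [hv α s hs] at h1
    have h2 := (((hasDerivWithinAt_id s (J α)).sub_const (s₀ α)).smul_const (w α)).const_add
      (g.π₂ (c α (s₀ α)))
    rw [one_smul] at h2
    exact h1.fun_add h2
  have hform : ∀ α, IsHelicalForm (J α) (μ α) g.V₁ (g.layerOp (l α)) (v α) ⟨w α, hwm α⟩ :=
    fun α => ⟨StratifiedLieAlgebra.layerOp_skew _,
      fun s hs => (hμd α s hs).derivWithin (hJ' α s hs)⟩
  refine ⟨μ, fun α => g.layerOp (l α), v, fun α => ⟨w α, hwm α⟩, fun α => (hform α).isQ (hJ' α)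
    fun s hs => (hμd α s hs).differentiableWithinAt, ⟨fun α s _ => ?_, fun α => ?_,
      _, v, fun α => ⟨w α, hwm α⟩, hform, fun x y => ?_⟩, hform, hwli, hwsp, fun α => ?_⟩
  · have h2 : g.π₂ (c α (s₀ α)) + (s - s₀ α) • w α ∈ g.V₂ :=
      g.V₂.add_mem (starProjection_apply_mem _ _) (g.V₂.smul_mem _ (hwm α))
    rw [hμ]
    simp only
    rw [map_add, (starProjection_apply_eq_zero_iff _).2 h2, add_zero,
      g.π₁_of_mem (starProjection_apply_mem _ _)]
  · simp only [hμ, sub_self, zero_smul, add_zero]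
    exact g.π₁_add_π₂ _
  · refine (eq_sum_inner_smul_of_dual hwm hlsp hd' (g.bracket_mem x y)).trans ?_
    exact Finset.sum_congr rfl fun α _ => by rw [StratifiedLieAlgebra.inner_layerOp]
  · refine horizontalSpace_congr (w := w α) fun s hs => ?_
    have h1 := (hred α).hasDerivWithinAt_π₁ hs
    rw [hv α s hs] at h1
    rw [(hform α).velocity s hs, h1.derivWithin (hJ' α s hs), add_comm]

theorem horizontalSpace_eq_bot_of_isAffineCurve {J : Set ℝ} (hJ : UniqueDiffOn ℝ J)
    {μ : ℝ → Euc d} (h : IsAffineCurve J μ) : horizontalSpace J μ = ⊥ := by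
  obtain ⟨a, b, hab⟩ := h
  have hd : ∀ s ∈ J, derivWithin μ J s = b := by
    intro s hs
    have h1 : HasDerivWithinAt (fun s : ℝ => a + s • b) b J s := by
      simpa using ((hasDerivWithinAt_id s J).smul_const b).const_add a
    exact (h1.congr hab (hab s hs)).derivWithin (hJ s hs)
  rw [horizontalSpace_congr (ν := fun _ => 0) (w := b) (fun s hs => by rw [hd s hs]; simp)]
  refine (Submodule.eq_bot_iff _).2 fun x hx => ?_
  refine (span_le (p := ⊥)).2 ?_ hx
  rintro y ⟨j, hj, s, hs, rfl⟩
  simp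

theorem StratifiedLieAlgebra.V₁_ne_bot (g : StratifiedLieAlgebra d) : g.V₁ ≠ ⊥ := by
  intro h
  refine g.step_two ?_
  rw [← g.generates, span_eq_bot]
  rintro z ⟨x, hx, y, -, rfl⟩
  rw [h, mem_bot] at hx
  rw [hx, map_zero, LinearMap.zero_apply]

theorem StratifiedLieAlgebra.IsDistinguished.exists_isCurveTuple {g : StratifiedLieAlgebra d}
    (hJ : ∀ α, (J α).OrdConnected ∧ (J α).Nontrivial) (hs₀ : ∀ α, s₀ α ∈ J α)
    (hc : g.IsDistinguished J s₀ c) :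
    ∃ μ, IsCurveTuple J s₀ g.V₁ μ ∧ g.Corresponds J s₀ μ c := by
  have hJ' : ∀ α, UniqueDiffOn ℝ (J α) := fun α => uniqueDiffOn_interval (hJ α).1 (hJ α).2
  obtain ⟨μ, A, v, w, hQ, hcor, hform, hli, hsp, hH⟩ := hc.momenta.exists_corresponds hJ hs₀
  have hH' : ∀ α, horizontalSpace (J α) (μ α) = g.V₁ := fun α => (hH α).trans (hc.full α)
  have hvd : ∀ α, verticalDirection (J α) (s₀ α) (μ α) = w α := fun α =>
    (hform α).verticalDirection_eq (hs₀ α) (hH' α)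
  refine ⟨μ, ⟨hQ, fun α haff => ?_, fun α => ?_, hH', ?_, ?_⟩, hcor⟩
  · exact g.V₁_ne_bot ((hH' α).symm.trans (horizontalSpace_eq_bot_of_isAffineCurve (hJ' α) haff))
  · refine ⟨w α, hli.ne_zero α, ⟪(w α : Euc d), w α⟫, fun s hs => ?_⟩
    beta_reduce
    rw [(hform α).velocity s hs, inner_add_right, real_inner_comm, (w α).2 _ (SetLike.coe_mem _),
      zero_add]
  · simpa only [hvd] using hli
  · simpa only [hvd] using hsp

/-- The horizontal projection determines the operators, and then the bracket determines the
vertical directions because the operators are linearly independent. -/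
theorem IsCurveTuple.eqOn_of_corresponds {g : StratifiedLieAlgebra d}
    (hJ : ∀ α, (J α).OrdConnected ∧ (J α).Nontrivial) (hs₀ : ∀ α, s₀ α ∈ J α)
    {μ' : Fin p → ℝ → Euc d} (hμ : IsCurveTuple J s₀ g.V₁ μ) (hc : g.Corresponds J s₀ μ c)
    (hμ' : IsCurveTuple J s₀ g.V₁ μ') (hc' : g.Corresponds J s₀ μ' c) (α : Fin p) :
    EqOn (μ α) (μ' α) (J α) := by
  have hJ' : ∀ α, UniqueDiffOn ℝ (J α) := fun α => uniqueDiffOn_interval (hJ α).1 (hJ α).2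
  obtain ⟨A, v, w, hA, -⟩ := hc.structure_eq
  obtain ⟨A', v', w', hA', -⟩ := hc'.structure_eq
  have hder : ∀ {ν : ℝ → Euc d} {α : Fin p}, IsQ 1 (J α) ν → ∀ s ∈ J α,
      HasDerivWithinAt ν (derivWithin ν (J α) s) (J α) s := fun h s hs =>
    (h.smooth.differentiableOn (by simp) s hs).hasDerivWithinAt
  have hhor : ∀ α, ∀ s ∈ J α, g.π₁ (derivWithin (μ α) (J α) s) =
      g.π₁ (derivWithin (μ' α) (J α) s) := by
    intro α s hs
    refine (hJ' α s hs).eq_deriv _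
      (g.π₁.hasFDerivAt.comp_hasDerivWithinAt s (hder (hμ.isQ α) s hs))
      ((g.π₁.hasFDerivAt.comp_hasDerivWithinAt s (hder (hμ'.isQ α) s hs)).congr
        (fun t ht => ?_) ?_)
    · exact (hc.projection α t ht).trans (hc'.projection α t ht).symm
    · exact (hc.projection α s hs).trans (hc'.projection α s hs).symm
  have hπ : ∀ {x : g.V₁} {y : g.V₁ᗮ}, g.π₁ ((x : Euc d) + y) = x := fun {x y} => by
    rw [map_add, g.π₁_of_mem x.2, (starProjection_apply_eq_zero_iff _).2 y.2, add_zero]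
  have hexp : ∀ α, ∀ s ∈ J α, ((expOp (s • A α) (v α) : g.V₁) : Euc d) =
      (expOp (s • A' α) (v' α) : g.V₁) := by
    intro α s hs
    have := hhor α s hs
    rwa [(hA α).velocity s hs, (hA' α).velocity s hs, hπ, hπ] at this
  have hAμ' : ∀ α, ∃ v w, IsHelicalForm (J α) (μ' α) g.V₁ (A α) v w := fun α =>
    ⟨v α, w' α, (hA α).skew, fun s hs => by rw [(hA' α).velocity s hs, hexp α s hs]⟩
  have hbr := hμ.bracket_eq_of_corresponds hJ' hs₀ (fun α => ⟨v α, w α, hA α⟩) rfl hc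
  have hbr' := hμ'.bracket_eq_of_corresponds hJ' hs₀ hAμ' rfl hc'
  have hAli : LinearIndependent ℝ A :=
    (linearIndependent_iff_span_operatorBracket hμ.vertical_linearIndependent
      hμ.vertical_span).2 (by rw [← hbr]; exact g.generates)
  have hw : ∀ α, (w α : Euc d) = w' α := by
    intro α
    rw [← (hA α).verticalDirection_eq (hs₀ α) (hμ.horizontal α),
      ← (hA' α).verticalDirection_eq (hs₀ α) (hμ'.horizontal α)]
    refine ext_inner_left ℝ fun φ => ?_
    rw [← sub_eq_zero, ← inner_sub_right]
    refine Fintype.linearIndependent_iff.1 hAli (fun α => ⟪φ, verticalDirection (J α) (s₀ α) (μ α) -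
      verticalDirection (J α) (s₀ α) (μ' α)⟫) ?_ α
    simp only [inner_sub_right, sub_smul, Finset.sum_sub_distrib]
    rw [sub_eq_zero]
    ext x : 1
    refine ext_inner_right ℝ fun y => ?_
    rw [← inner_operatorBracket (w := fun α => verticalDirection (J α) (s₀ α) (μ α)), ← hbr, hbr',
      inner_operatorBracket]
  refine eqOn_of_hasDerivWithinAt (hJ α).1 (hder (hμ.isQ α)) (fun s hs => ?_) (hs₀ α)
    ((hc.base α).trans (hc'.base α).symm)
  rw [(hA α).velocity s hs, hexp α s hs, hw α, ← (hA' α).velocity s hs]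
  exact hder (hμ'.isQ α) s hs

end Correspondence

end HelicalCarnot

theorem mainTheorem6 {d p : ℕ} (hp : 0 < p) (J : Fin p → Set ℝ) (s₀ : Fin p → ℝ)
    (hJ : ∀ α, (J α).OrdConnected ∧ (J α).Nontrivial) (hs₀ : ∀ α, s₀ α ∈ J α) :
    -- from curves to Lie algebras and geodesics
    (∀ (H : Submodule ℝ (Euc d)) (μ : Fin p → ℝ → Euc d), IsCurveTuple J s₀ H μ →
      ∃ A : Fin p → H →L[ℝ] H,
        -- the canonical skew-symmetric operators of the curves
        (∀ α, Function.Bijective (A α) ∧ ∃ v w, IsHelicalForm (J α) (μ α) H (A α) v w) ∧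
        (∀ A' : Fin p → H →L[ℝ] H,
          (∀ α, ∃ v w, IsHelicalForm (J α) (μ α) H (A' α) v w) → A' = A) ∧
        -- existence
        (LinearIndependent ℝ A ↔ ∃ (g : StratifiedLieAlgebra d) (c : Fin p → ℝ → Euc d),
          g.V₁ = H ∧ g.IsDistinguished J s₀ c ∧ g.Corresponds J s₀ μ c) ∧
        -- uniqueness
        (∀ (g g' : StratifiedLieAlgebra d) (c c' : Fin p → ℝ → Euc d),
          g.V₁ = H → (∀ α, g.IsNormalGeodesic (J α) (c α)) → g.Corresponds J s₀ μ c →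
          g'.V₁ = H → (∀ α, g'.IsNormalGeodesic (J α) (c' α)) → g'.Corresponds J s₀ μ c' →
          g = g' ∧ ∀ α, EqOn (c α) (c' α) (J α))) ∧
    -- from Lie algebras and distinguished geodesics to curves
    (∀ (g : StratifiedLieAlgebra d) (c : Fin p → ℝ → Euc d), g.IsDistinguished J s₀ c →
      (∃ μ, IsCurveTuple J s₀ g.V₁ μ ∧ g.Corresponds J s₀ μ c) ∧
      ∀ μ μ', IsCurveTuple J s₀ g.V₁ μ → g.Corresponds J s₀ μ c →
        IsCurveTuple J s₀ g.V₁ μ' → g.Corresponds J s₀ μ' c → ∀ α, EqOn (μ α) (μ' α) (J α)) ∧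
    -- arbitrary step-two stratified Lie algebras
    (∀ (g : StratifiedLieAlgebra d) (c : Fin p → ℝ → Euc d),
      (∀ α, g.IsNormalGeodesic (J α) (c α)) → g.HasMomentumBasis J s₀ c →
      ∃ μ : Fin p → ℝ → Euc d, (∀ α, IsQ 1 (J α) (μ α)) ∧ g.Corresponds J s₀ μ c) := by
  have hJ' : ∀ α, UniqueDiffOn ℝ (J α) := fun α => uniqueDiffOn_interval (hJ α).1 (hJ α).2
  refine ⟨fun H μ hμ => ?_, fun g c hc => ⟨hc.exists_isCurveTuple hJ hs₀, ?_⟩, fun g c _ hc => ?_⟩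
  · choose A hbij hA using fun α =>
      (hμ.isQ α).exists_isHelicalForm (hJ α).1 (hJ α).2 (hμ.horizontal α)
    refine ⟨A, fun α => ⟨hbij α, hA α⟩, fun A' hA' => funext fun α => ?_,
      ⟨hμ.exists_corresponds hp hJ hs₀ hA, ?_⟩, ?_⟩
    · obtain ⟨v, w, h⟩ := hA α
      obtain ⟨v', w', h'⟩ := hA' α
      exact h'.operator_unique (hJ' α) (hμ.horizontal α) h
    · rintro ⟨g, c, hg, -, hc⟩
      have hgen := g.generates
      rw [hμ.bracket_eq_of_corresponds hJ' hs₀ hA hg hc, hg] at hgen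
      exact (linearIndependent_iff_span_operatorBracket hμ.vertical_linearIndependent
        hμ.vertical_span).2 hgen
    · intro g g' c c' hg hgeo hc hg' hgeo' hc'
      obtain rfl : g = g' := StratifiedLieAlgebra.ext (hg.trans hg'.symm)
        ((hμ.bracket_eq_of_corresponds hJ' hs₀ hA hg hc).trans
          (hμ.bracket_eq_of_corresponds hJ' hs₀ hA hg' hc').symm)
      exact ⟨rfl, fun α => (hgeo α).eqOn (hJ α).1 (hJ α).2 (hs₀ α) (hgeo' α)
        (fun s hs => (hc.projection α s hs).symm.trans (hc'.projection α s hs))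
        ((hc.base α).symm.trans (hc'.base α))⟩
  · exact fun μ μ' hμ hc hμ' hc' => hμ.eqOn_of_corresponds hJ hs₀ hc hμ' hc'
  · obtain ⟨μ, A, v, w, hQ, hcor, -⟩ := hc.exists_corresponds hJ hs₀
    exact ⟨μ, hQ, hcor⟩
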